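/- **Theorem 4.4.** Let $\mathcal H_1$ be a finite-dimensional complex Hilbert space of dimension $N$ (inner products are conjugate linear in the first variable) and let $Z$ be a CAR field over $\mathcal H_1$ acting irreducibly on a nonzero finite-dimensional Hilbert space $\mathscr K$: $\psi\mapsto Z(\psi)\in\mathscr B(\mathscr K)$ is conjugate linear, $Z(\psi)Z^*(\phi)+Z^*(\phi)Z(\psi)=\langle\psi,\phi\rangle\mathbf 1$ and $Z(\psi)Z(\phi)+Z(\phi)Z(\psi)=0$ for all $\psi,\phi$, where $Z^*(\phi):=Z(\phi)^*$. The CAR algebra generated by the $Z(\psi)$ is then $\mathscr B(\mathscr K)$. *Notation.* Let $\tau={\rm Tr}/\dim$ be the normalized trace; $\Phi^\dagger$ is the adjoint of a linear map $\Phi$ for $\langle X,Y\rangle=\tau(X^*Y)$. For an operator $X=\sum_j|a_j\rangle\langle b_j|$ on $\mathcal H_1$ put $\widehat X=\sum_jZ^*(a_j)Z(b_j)$; put $\mathcal N=\widehat{\mathbf 1}$ and $W=e^{i\pi\mathcal N}$. On $\mathscr K\otimes\mathscr K$, $Z(\psi\oplus\eta)=Z(\psi)\otimes W+\mathbf 1\otimes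 Z(\eta)$ is a CAR field over $\mathcal H_1\oplus\mathcal H_1$. For operators with $0\le R\le\mathbf 1-SS^*$, let $T_{S,R}$ be the operator with $0\le T_{S,R}\le \mathbf 1$, $\ker(\mathbf 1-SS^*)\subseteq\ker T_{S,R}$ and $R=(\mathbf 1-SS^*)^{1/2}T_{S,R}(\mathbf 1-SS^*)^{1/2}$, and let $$U_S=\begin{bmatrix}-(\mathbf 1-SS^*)^{1/2}&S\\ S^*&(\mathbf 1-S^*S)^{1/2}\end{bmatrix},$$ a self-adjoint unitary on $\mathcal H_1\oplus\mathcal H_1$. The Evans–Hugenholtz–Kadison operation on $\mathscr B(\mathscr K)$ is $\Phi_{S,R}(\rho)=\mathbb E(V^*\rho_{T_{S,R}}\,\rho\,V)$. Here $\rho$ is placed in the algebra of the $Z(0\oplus\eta)$ via $Z(\eta)\mapsto Z(0\oplus\eta)$; if $T_{S,R}=\sum_j\mu_j|\psi_j\rangle\langle\psi_j|$ with $\{\psi_j\}$ orthonormal, then $\rho_{T_{S,R}}=\prod_j\bigl(2(1-\mu_j)A_jA_j^*+2\mu_jA_j^*A_j\bigr)$ with $A_j=Z(\psi_j\oplus0)$;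 $V$ is a unitary with $VZ(\xi)V^*=Z(U_S\xi)$ for all $\xi\in\mathcal H_1\oplus\mathcal H_1$; and $\mathbb E$ is the $\tau$-preserving conditional expectation onto the algebra generated by the $Z(\psi\oplus0)$, which is identified with $\mathscr B(\mathscr K)$ via $Z(\psi\oplus0)\mapsto Z(\psi)$. *Statement.* Let $G,A$ be operators on $\mathcal H_1$ with $0\le A\le-G-G^*$ (so that $G$ generates a contraction semigroup), and put $$R_t=\int_0^te^{sG}Ae^{sG^*}\,ds,\qquad H=-\tfrac12(G+G^*),\qquad K=\tfrac1{2i}(G-G^*),$$ so that $G^*=-H-iK$. Then the limit $$T=\lim_{\epsilon\downarrow0}(2H+\epsilon\mathbf 1)^{-1/2}A(2H+\epsilon\mathbf 1)^{-1/2}$$ exists and $0\le T\le\mathbf 1$. Let $\{\eta_1,\dots,\eta_N\}$ be any orthonormal basis of $\mathcal H_1$ with $T\eta_j=\lambda_j\eta_j$, and put $\phi_j=(2H)^{1/2}\eta_j$. Then $0\le\lambda_j\le1$, and for every $X\in\mathscr B(\mathscr K)$ the limit $\mathscr L^\dagger_{G,A}(X)=\lim_{t\downarrow0}\frac1t\bigl(\Phi^\dagger_{e^{tG},R_t}(X)-X\bigr)$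 exists and $$\begin{aligned}\mathscr L^\dagger_{G,A}(X)&=\sum_{j=1}^N(1-\lambda_j)\bigl(Z^*(\phi_j)WXWZ(\phi_j)-\tfrac12Z^*(\phi_j)Z(\phi_j)X-\tfrac12XZ^*(\phi_j)Z(\phi_j)\bigr)\\&\quad+\sum_{j=1}^N\lambda_j\bigl(Z(\phi_j)WXWZ^*(\phi_j)-\tfrac12Z(\phi_j)Z^*(\phi_j)X-\tfrac12XZ(\phi_j)Z^*(\phi_j)\bigr)-i[\widehat K,X].\end{aligned}$$ -/

import Mathlib

open scoped TensorProduct InnerProductSpace Topology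
open Filter TensorProduct

namespace CAR

noncomputable section

/-- Finite-dimensional complex inner product spaces are complete, so that all operators below have
adjoints and their spaces of operators are C*-algebras. -/
instance instCompleteSpaceOfFiniteDimensional (E : Type*) [NormedAddCommGroup E]
    [InnerProductSpace ℂ E] [FiniteDimensional ℂ E] : CompleteSpace E :=
  FiniteDimensional.complete ℂ E

/-- The algebra of (bounded) operators on `E`. -/
abbrev Op (E : Type*) [NormedAddCommGroup E] [InnerProductSpace ℂ E] : Type _ := E →L[ℂ] E

section General

variable {H K K' : Type*}
  [NormedAddCommGroup H] [InnerProductSpace ℂ H] [FiniteDimensional ℂ H]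
  [NormedAddCommGroup K] [InnerProductSpace ℂ K] [FiniteDimensional ℂ K]
  [NormedAddCommGroup K'] [InnerProductSpace ℂ K'] [FiniteDimensional ℂ K']

/-! ### CAR fields -/

/-- The canonical anti-commutation relations for a conjugate linear map `Z` from the single
particle space `H` to the operators on `K`; `Z*(φ)` is `star (Z φ)`, the Hilbert space adjoint.
The relation `Z*(ψ)Z*(φ) + Z*(φ)Z*(ψ) = 0` is the adjoint of the second one. -/
structure IsCARField (Z : H →ₗ⋆[ℂ] Op K) : Prop where
  anticomm_star : ∀ ψ φ : H,
    Z ψ * star (Z φ) + star (Z φ) * Z ψ = ⟪ψ, φ⟫_ℂ • (1 : Op K)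
  anticomm : ∀ ψ φ : H, Z ψ * Z φ + Z φ * Z ψ = 0

/-- `Z` acts irreducibly on `K`: `K` is nonzero and has no non-trivial subspace invariant under all
`Z ψ` and `Z*(ψ)`. -/
def ActsIrreducibly (Z : H → Op K) : Prop :=
  Nontrivial K ∧ ∀ M : Submodule ℂ K,
    (∀ ψ : H, ∀ v ∈ M, Z ψ v ∈ M ∧ star (Z ψ) v ∈ M) → M = ⊥ ∨ M = ⊤

/-- Second quantization of an operator: for `X = ∑ⱼ |aⱼ⟩⟨bⱼ|` it is `X̂ = ∑ⱼ Z*(aⱼ) Z(bⱼ)`, here with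
`aⱼ = X eⱼ`, `bⱼ = eⱼ` for an orthonormal basis `e` (it does not depend on the choice). -/
def secondQuant (Z : H → Op K) (X : Op H) : Op K :=
  ∑ j, star (Z (X (stdOrthonormalBasis ℂ H j))) * Z (stdOrthonormalBasis ℂ H j)

/-- The number operator `𝒩 = ∑ⱼ Z*(eⱼ) Z(eⱼ)`. -/
def numberOp (Z : H → Op K) : Op K := secondQuant Z 1

/-- The self-adjoint unitary `W = e^{iπ𝒩} = (-1)^𝒩`, which anticommutes with all `Z ψ`; the
principal automorphism is `X ↦ W X W`. -/
def parityOp (Z : H → Op K) : Op K :=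
  NormedSpace.exp (((Real.pi : ℂ) * Complex.I) • numberOp Z)

/-- A unitary on `K` which implements the unitary `U` on `H`, that is `V Z(ψ) V* = Z(U ψ)` for all
`ψ`. For an irreducible CAR field and a unitary `U` it exists and is unique up to a phase; only
conjugation by it is used, and the phase has no effect on that. -/
def implementer (Z : H → Op K) (U : Op H) : Op K :=
  open Classical in
  if h : ∃ V ∈ unitary (Op K), ∀ ψ : H, V * Z ψ * star V = Z (U ψ) then h.choose else 1

/-- The density matrix, with respect to the normalized trace, of the gauge invariant Gaussian state
with symbol `Q`: if `Q = ∑ⱼ μⱼ |ψⱼ⟩⟨ψⱼ|` with `ψ` an orthonormal basis, it is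
`∏ⱼ ((1 - μⱼ) 2 Z(ψⱼ) Z*(ψⱼ) + μⱼ 2 Z*(ψⱼ) Z(ψⱼ))`, a product of commuting factors. (Junk value `0`
if `Q` is not self-adjoint.) -/
def gaussianDensity (Z : H → Op K) (Q : Op H) : Op K :=
  open Classical in
  if hQ : (Q : H →ₗ[ℂ] H).IsSymmetric then
    (List.ofFn fun j : Fin (Module.finrank ℂ H) =>
      (((1 - hQ.eigenvalues rfl j : ℝ) : ℂ) * 2) •
          (Z (hQ.eigenvectorBasis rfl j) * star (Z (hQ.eigenvectorBasis rfl j)))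
        + (((hQ.eigenvalues rfl j : ℝ) : ℂ) * 2) •
          (star (Z (hQ.eigenvectorBasis rfl j)) * Z (hQ.eigenvectorBasis rfl j))).prod
  else 0

/-! ### The normalized trace and adjoints with respect to it -/

/-- The normalized trace `τ(X) = Tr X / dim K`. -/
def tau (X : Op K) : ℂ :=
  LinearMap.trace ℂ K (X : K →ₗ[ℂ] K) / (Module.finrank ℂ K : ℂ)

/-- The adjoint `Φ†` of a linear map `Φ` between operator algebras with respect to the inner
products `τ(X* Y)`: the linear map with `τ(Φ(Y)* X) = τ(Y* Φ†(X))`, see `tau_tracialAdjoint`. It is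
written out in the matrix units `|eᵢ⟩⟨eⱼ|`. -/
def tracialAdjoint (Φ : Op K →ₗ[ℂ] Op K') : Op K' →ₗ[ℂ] Op K where
  toFun X := ∑ i, ∑ j, ((Module.finrank ℂ K : ℂ) *
      tau (star (Φ (InnerProductSpace.rankOne ℂ (stdOrthonormalBasis ℂ K i)
        (stdOrthonormalBasis ℂ K j))) * X)) •
    InnerProductSpace.rankOne ℂ (stdOrthonormalBasis ℂ K i) (stdOrthonormalBasis ℂ K j)
  map_add' X Y := by
    simp only [tau, mul_add, ContinuousLinearMap.toLinearMap_add, map_add, add_div, add_smul,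
      Finset.sum_add_distrib]
  map_smul' c X := by
    simp only [tau, mul_smul_comm, ContinuousLinearMap.toLinearMap_smul, map_smul, smul_eq_mul,
      RingHom.id_apply, Finset.smul_sum, smul_smul]
    refine Finset.sum_congr rfl fun i _ => Finset.sum_congr rfl fun j _ => ?_
    congr 1
    ring

/-- Expansion of an operator in the matrix units of an orthonormal basis. -/
theorem eq_sum_rankOne (Y : Op K) :
    Y = ∑ i, ∑ j, ⟪stdOrthonormalBasis ℂ K i, Y (stdOrthonormalBasis ℂ K j)⟫_ℂ •
      InnerProductSpace.rankOne ℂ (stdOrthonormalBasis ℂ K i) (stdOrthonormalBasis ℂ K j) := by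
  refine ContinuousLinearMap.coe_injective ((stdOrthonormalBasis ℂ K).toBasis.ext fun k => ?_)
  simp only [OrthonormalBasis.coe_toBasis, ContinuousLinearMap.coe_coe,
    _root_.sum_apply, _root_.smul_apply,
    InnerProductSpace.rankOne_apply, OrthonormalBasis.inner_eq_ite, ite_smul, one_smul, zero_smul,
    smul_ite, smul_zero, Finset.sum_ite_eq', Finset.mem_univ, if_true]
  exact ((stdOrthonormalBasis ℂ K).sum_repr' _).symm

/-- The defining property of `tracialAdjoint`. -/
theorem tau_tracialAdjoint (Φ : Op K →ₗ[ℂ] Op K') (Y : Op K)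
    (X : Op K') : tau (star (Φ Y) * X) = tau (star Y * tracialAdjoint Φ X) := by
  classical
  set e := stdOrthonormalBasis ℂ K with he
  have hL : tau (star (Φ Y) * X) = ∑ i, ∑ j, star ⟪e i, Y (e j)⟫_ℂ *
      tau (star (Φ (InnerProductSpace.rankOne ℂ (e i) (e j))) * X) := by
    conv_lhs => rw [eq_sum_rankOne Y]
    simp only [tau, map_sum, map_smul, star_sum, star_smul, Finset.sum_mul, smul_mul_assoc,
      ContinuousLinearMap.toLinearMap_sum, ContinuousLinearMap.toLinearMap_smul, Finset.sum_div,
      smul_eq_mul, mul_div_assoc, ← he]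
  have hR : ∀ i j, (Module.finrank ℂ K : ℂ) *
      tau (star Y * InnerProductSpace.rankOne ℂ (e i) (e j)) = star ⟪e i, Y (e j)⟫_ℂ := by
    intro i j
    have hd : (Module.finrank ℂ K : ℂ) ≠ 0 := by
      have : 0 < Module.finrank ℂ K := i.pos
      exact_mod_cast this.ne'
    have h1 : star Y * InnerProductSpace.rankOne ℂ (e i) (e j)
        = InnerProductSpace.rankOne ℂ (star Y (e i)) (e j) := by
      ext v
      simp
    rw [h1, tau, mul_div_cancel₀ _ hd, InnerProductSpace.trace_rankOne,
      ContinuousLinearMap.star_eq_adjoint, ContinuousLinearMap.adjoint_inner_right]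
    exact (inner_conj_symm _ _).symm
  have hadd : ∀ c : ℂ, ∀ B : Op K, tau (c • B) = c * tau B := by
    intro c B
    simp [tau, mul_div_assoc]
  have hsum : ∀ f : Fin (Module.finrank ℂ K) → Op K, tau (∑ i, f i) = ∑ i, tau (f i) := by
    intro f
    simp [tau, Finset.sum_div, ContinuousLinearMap.toLinearMap_sum]
  rw [hL]
  simp only [tracialAdjoint, LinearMap.coe_mk, AddHom.coe_mk, Finset.mul_sum, mul_smul_comm, hsum,
    hadd, ← he, ← hR]
  refine Finset.sum_congr rfl fun i _ => Finset.sum_congr rfl fun j _ => ?_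
  ring

/-! ### Functions of operators on the single particle space -/

/-- `D ↦ (D⁺)^{1/2}` for `D ≥ 0`, with `D⁺` the Moore–Penrose generalized inverse: the eigenvalue `x`
is replaced by `x^{-1/2}` if `x > 0` and by `0` if `x = 0`. For invertible `D` it is `D^{-1/2}`. -/
def invSqrt (D : Op H) : Op H := cfc (fun x : ℝ => (Real.sqrt x)⁻¹) D

/-- The self-adjoint unitary dilation
`U_S = [-(1 - S S*)^{1/2}, S; S*, (1 - S* S)^{1/2}]` of a contraction `S`, on the Hilbert space
direct sum `H ⊕ H`. -/
def dilation (S : Op H) : Op (WithLp 2 (H × H)) :=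
  ((WithLp.prodContinuousLinearEquiv 2 ℂ H H).symm : (H × H) →L[ℂ] WithLp 2 (H × H)) ∘L
    ((((-CFC.sqrt (1 - S * star S)).coprod S).prod
      ((star S).coprod (CFC.sqrt (1 - star S * S)))) ∘L
    ((WithLp.prodContinuousLinearEquiv 2 ℂ H H) : WithLp 2 (H × H) →L[ℂ] (H × H)))

/-- For a compatible pair `0 ≤ R ≤ 1 - S S*`, the operator `T` with `0 ≤ T ≤ 1`,
`ker (1 - S S*) ⊆ ker T` and `R = (1 - S S*)^{1/2} T (1 - S S*)^{1/2}`. -/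
def ancillaSymbol (S R : Op H) : Op H :=
  invSqrt (1 - S * star S) * R * invSqrt (1 - S * star S)

/-! ### The Evans–Hugenholtz–Kadison construction -/

/-- The CAR field over `H ⊕ H` on `K ⊗ K` given by `Z(ψ ⊕ η) = Z(ψ) ⊗ W + 1 ⊗ Z(η)`. -/
def doubled (Z : H → Op K) (ξ : WithLp 2 (H × H)) : Op (K ⊗[ℂ] K) :=
  mapL (Z ξ.fst) (parityOp Z) + mapL (1 : Op K) (Z ξ.snd)

/-- The embedding of the CAR algebra over `H` onto the subalgebra generated by the
`Z(ψ ⊕ 0) = Z(ψ) ⊗ W`, that is, the `*`-homomorphism with `Z(ψ) ↦ Z(ψ ⊕ 0)`. It maps `X` to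
`X₀ ⊗ 1 + X₁ ⊗ W` where `X₀ = (X + W X W)/2` and `X₁ = (X - W X W)/2` are the even and odd parts
of `X`. -/
def embedLeft (Z : H → Op K) : Op K →ₗ[ℂ] Op (K ⊗[ℂ] K) where
  toFun X :=
    mapL ((1 / 2 : ℂ) • (X + parityOp Z * X * parityOp Z)) (1 : Op K)
      + mapL ((1 / 2 : ℂ) • (X - parityOp Z * X * parityOp Z)) (parityOp Z)
  map_add' X Y := by
    simp only [mul_add, add_mul, mapL_add_left, mapL_smul_left, sub_eq_add_neg, smul_add, neg_add]
    abel
  map_smul' c X := by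
    simp only [mul_smul_comm, smul_mul_assoc, ← smul_add, ← smul_sub, mapL_smul_left,
      RingHom.id_apply]
    simp only [smul_add, smul_smul, mul_comm c]

/-- The embedding of the CAR algebra over `H` onto the subalgebra generated by the
`Z(0 ⊕ η) = 1 ⊗ Z(η)`, with `Z(η) ↦ Z(0 ⊕ η)`. -/
def embedRight : Op K →ₗ[ℂ] Op (K ⊗[ℂ] K) where
  toFun Y := mapL (1 : Op K) Y
  map_add' X Y := mapL_add_right _ X Y
  map_smul' c X := mapL_smul_right c _ X

/-- The tracial conditional expectation onto the image `𝒜` of `embedLeft Z`, followed by the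
identification of `𝒜` with the operators on `K`. The conditional expectation of `Y` is the unique
element `E(Y)` of `𝒜` with `τ(B* E(Y)) = τ(B* Y)` for all `B ∈ 𝒜`; as the embedding preserves `τ`,
it is the adjoint of the embedding. -/
def condExpLeft (Z : H → Op K) : Op (K ⊗[ℂ] K) →ₗ[ℂ] Op K :=
  tracialAdjoint (embedLeft Z)

/-- The Evans–Hugenholtz–Kadison operation `Φ_{S,R}(ρ) = 𝔼_𝒜(α̂_{U_S}(ρ_T ρ))`. Here `ρ_T` is the
Gaussian density matrix with symbol `T = ancillaSymbol S R` in the algebra of the fields `Z(ψ ⊕ 0)`,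
`ρ` is placed in the algebra of the fields `Z(0 ⊕ η)`, and `α̂_{U_S}(σ) = V* σ V`, with `V`
implementing `U_S`, is the dual of the automorphism `α_{U_S}(X) = V X V*`. -/
def ehk (Z : H → Op K) (S R : Op H) : Op K →ₗ[ℂ] Op K :=
  condExpLeft Z
    ∘ₗ LinearMap.mulLeft ℂ (star (implementer (doubled Z) (dilation S)))
    ∘ₗ LinearMap.mulRight ℂ (implementer (doubled Z) (dilation S))
    ∘ₗ LinearMap.mulLeft ℂ
        (gaussianDensity (fun ψ : H => doubled Z (WithLp.toLp 2 (ψ, 0))) (ancillaSymbol S R))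
    ∘ₗ embedRight

/-- `Φ†_{S,R}`, the adjoint of `Φ_{S,R}` with respect to the inner product `τ(X* Y)`. -/
def ehkDual (Z : H → Op K) (S R : Op H) : Op K →ₗ[ℂ] Op K :=
  tracialAdjoint (ehk Z S R)

/-- `R_t = ∫₀ᵗ e^{sG} A e^{sG*} ds`. -/
def covarianceIntegral (G A : Op H) (t : ℝ) : Op H :=
  ∫ s in (0 : ℝ)..t,
    NormedSpace.exp ((s : ℂ) • G) * A * NormedSpace.exp ((s : ℂ) • star G)

/-- `H := -(G + G*)/2`. -/
def dissipativePart (G : Op H) : Op H := -((1 / 2 : ℂ) • (G + star G))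

/-- `K := (G - G*)/(2i)`, so that `G = -H + iK` and `G* = -H - iK`. -/
def hamiltonianPart (G : Op H) : Op H := (1 / (2 * Complex.I)) • (G - star G)

end General

end

end CAR

open CAR

/-! In the Heisenberg picture the dual operation is a homomorphism followed by an average. With `S =
e^{tG}`, `D = -G - G*` and `Q = (1 - SS*)^{1/2}`, let `α_t(X) = V X V*` on the left copy
(`dilated`), and let `E_t` be the average over the left factor in the Gaussian state with the
ancilla symbol `T_t` (`noiseExpect`). Then `Φ†(X) = E_t(α_t(X))` (`IsCARField.ehkDual_eq`). The map
`α_t` is a `*`-homomorphism with `α_t(Zψ) = Z(-Qψ ⊕ 0) + Z(0 ⊕ S*ψ)`, a noise of size `O(√t)` plus a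
drift, and `E_t` is a bimodule map over the right copy that kills single noise fields.

By Burnside's theorem (`ActsIrreducibly.adjoin_eq_top`) the fields and their adjoints generate all
operators. It therefore suffices that the `X` on which the derivative exists and equals the claimed
`L(X)` contain the fields and are stable under sums and products. On a field the derivative is
`Z(G*ψ)`, and so is the value of `L` (`IsCARField.lindblad_field`). For products, write `α(XY) =
(α(X) - X)(α(Y) - Y) + α(X)Y + Xα(Y) - XY`. The last three terms contribute `L(X)Y + XL(Y)`. In the
first, each factor may be replaced by its part linear in the noise (`linearNoise`), with an error of
order `t^{3/2}`, so only two-point functions of the noise remain. These are matrix elements of `Q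
T_t Q = R_t ≈ tA` and `Q² ≈ tD`; the symbol `T_t` occurs only between two factors `Q`, so its own
limit is never needed.

On the algebraic side, `L(XY) - L(X)Y - XL(Y)` is a sum of products of graded commutators with the
fields (`IsCARField.lindblad_mul`). It depends on the noise vectors only through `∑ |φ_l⟩⟨φ_l| = D`
and `∑ λ_l |φ_l⟩⟨φ_l| = D^{1/2} T D^{1/2} = A`, and so it agrees with the limit of the quadratic
noise term. The parity `W` enters because the left noise carries `W` in the right factor: moving a
right operator past it conjugates by `W`.

The limit defining `T` exists because `0 ≤ A ≤ D` confines `A` to the support of `D`, where the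
regularized inverse square roots converge. -/

set_option linter.unusedSectionVars false

namespace CAR

noncomputable section

section General

variable {H K K' : Type*}
  [NormedAddCommGroup H] [InnerProductSpace ℂ H] [FiniteDimensional ℂ H]
  [NormedAddCommGroup K] [InnerProductSpace ℂ K] [FiniteDimensional ℂ K]
  [NormedAddCommGroup K'] [InnerProductSpace ℂ K'] [FiniteDimensional ℂ K']

/-- Operators form a rational normed algebra, as required for the exponential series. -/
instance instNormedAlgebraRatOp : NormedAlgebra ℚ (Op K) := NormedAlgebra.restrictScalars ℚ ℂ (Op K)

/-! ### CAR identities, the parity operator, and implementation of self-adjoint unitaries -/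

section CARAlgebra

variable {Z : H →ₗ⋆[ℂ] Op K}

theorem IsCARField.star_anticomm (hZ : IsCARField Z) (ψ φ : H) :
    star (Z ψ) * star (Z φ) + star (Z φ) * star (Z ψ) = 0 := by
  have h := congrArg star (hZ.anticomm φ ψ)
  simpa using h

theorem IsCARField.mul_self (hZ : IsCARField Z) (ψ : H) : Z ψ * Z ψ = 0 := by
  have h := hZ.anticomm ψ ψ
  rw [← two_smul ℂ] at h
  simpa using h

theorem IsCARField.star_mul_eq (hZ : IsCARField Z) (ψ φ : H) :
    star (Z φ) * Z ψ = ⟪ψ, φ⟫_ℂ • (1 : Op K) - Z ψ * star (Z φ) :=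
  eq_sub_of_add_eq' (hZ.anticomm_star ψ φ)

theorem IsCARField.mul_eq_neg (hZ : IsCARField Z) (ψ φ : H) : Z ψ * Z φ = -(Z φ * Z ψ) :=
  eq_neg_of_add_eq_zero_left (hZ.anticomm ψ φ)

/-- A conjugate linear field expands in an orthonormal basis. -/
theorem map_eq_sum_inner {ι : Type*} [Fintype ι] (e : OrthonormalBasis ι ℂ H) (Z : H →ₗ⋆[ℂ] Op K)
    (ψ : H) : Z ψ = ∑ j, ⟪ψ, e j⟫_ℂ • Z (e j) := by
  conv_lhs => rw [← e.sum_repr' ψ]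
  simp [map_sum]

theorem star_map_eq_sum_inner {ι : Type*} [Fintype ι] (e : OrthonormalBasis ι ℂ H)
    (Z : H →ₗ⋆[ℂ] Op K) (ψ : H) : star (Z ψ) = ∑ j, ⟪e j, ψ⟫_ℂ • star (Z (e j)) := by
  conv_lhs => rw [map_eq_sum_inner e Z ψ]
  simp [star_sum, star_smul]

theorem IsCARField.star_mul_mul_sub (hZ : IsCARField Z) (a b ψ : H) :
    star (Z a) * Z b * Z ψ - Z ψ * (star (Z a) * Z b) = -(⟪ψ, a⟫_ℂ • Z b) := by
  have h1 := hZ.anticomm_star ψ a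
  have h2 := hZ.anticomm b ψ
  have : star (Z a) * Z b * Z ψ - Z ψ * (star (Z a) * Z b)
      = star (Z a) * (Z b * Z ψ + Z ψ * Z b) - (Z ψ * star (Z a) + star (Z a) * Z ψ) * Z b := by
    noncomm_ring
  rw [this, h1, h2]
  simp

/-- The commutator of a second quantization with the field. -/
theorem IsCARField.secondQuant_comm (hZ : IsCARField Z) (X : Op H) (ψ : H) :
    secondQuant Z X * Z ψ - Z ψ * secondQuant Z X = -Z (star X ψ) := by
  rw [secondQuant, Finset.sum_mul, Finset.mul_sum, ← Finset.sum_sub_distrib]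
  simp only [hZ.star_mul_mul_sub]
  rw [Finset.sum_neg_distrib, map_eq_sum_inner (stdOrthonormalBasis ℂ H) Z (star X ψ)]
  simp [ContinuousLinearMap.star_eq_adjoint, ContinuousLinearMap.adjoint_inner_left]

theorem star_secondQuant (Z : H →ₗ⋆[ℂ] Op K) (X : Op H) :
    star (secondQuant Z X) = secondQuant Z (star X) := by
  simp only [secondQuant, star_sum, star_mul, star_star]
  set e := stdOrthonormalBasis ℂ H
  have h1 : ∀ j, star (Z (e j)) * Z (X (e j))
      = ∑ k, ⟪X (e j), e k⟫_ℂ • (star (Z (e j)) * Z (e k)) := fun j => by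
    rw [map_eq_sum_inner e Z (X (e j)), Finset.mul_sum]
    simp
  have h2 : ∀ k, star (Z (star X (e k))) * Z (e k)
      = ∑ j, ⟪X (e j), e k⟫_ℂ • (star (Z (e j)) * Z (e k)) := fun k => by
    rw [star_map_eq_sum_inner e Z (star X (e k)), Finset.sum_mul]
    simp [ContinuousLinearMap.star_eq_adjoint, ContinuousLinearMap.adjoint_inner_right]
  rw [Finset.sum_congr rfl fun j _ => h1 j, Finset.sum_congr rfl fun j _ => h2 j]
  exact Finset.sum_comm

theorem exp_mem_unitary {N : Op K} (hN : star N = N) (r : ℝ) :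
    NormedSpace.exp (((r : ℂ) * Complex.I) • N) ∈ unitary (Op K) := by
  have h : star (((r : ℂ) * Complex.I) • N) = -(((r : ℂ) * Complex.I) • N) := by
    simp [star_smul, hN]
  rw [Unitary.mem_iff, NormedSpace.star_exp, h,
    ← NormedSpace.exp_add_of_commute (Commute.neg_left (Commute.refl _)),
    ← NormedSpace.exp_add_of_commute (Commute.neg_right (Commute.refl _))]
  simp

theorem exp_smul_one (c : ℂ) : NormedSpace.exp (c • (1 : Op K)) = Complex.exp c • (1 : Op K) := by
  have := NormedSpace.algebraMap_exp_comm (𝕂 := ℂ) (𝔸 := Op K) c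
  rw [Algebra.algebraMap_eq_smul_one, Algebra.algebraMap_eq_smul_one,
    ← Complex.exp_eq_exp_ℂ] at this
  exact this.symm

/-- The hypothesis says `N B = B (N - 1)`, so `e^{cN} B = B e^{cN} e^{-c}`, and `e^{-iπ} = -1`. -/
theorem exp_mul_eq_neg_mul_exp {N B : Op K} (h : N * B - B * N = -B) :
    NormedSpace.exp (((Real.pi : ℂ) * Complex.I) • N) * B
      = -(B * NormedSpace.exp (((Real.pi : ℂ) * Complex.I) • N)) := by
  set c : ℂ := (Real.pi : ℂ) * Complex.I with hc
  have h1 : SemiconjBy B (c • N + (-c) • (1 : Op K)) (c • N) := by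
    have : N * B = B * N - B := by rw [sub_eq_iff_eq_add] at h; rw [h]; abel
    simp only [SemiconjBy, smul_mul_assoc, mul_add, mul_smul_comm, this, mul_one]
    module
  have h2 := h1.exp_right
  have h3 : Complex.exp (-c) = -1 := by rw [Complex.exp_neg, hc, Complex.exp_pi_mul_I]; norm_num
  rw [NormedSpace.exp_add_of_commute ((Commute.one_right _).smul_right _), exp_smul_one,
    SemiconjBy, h3] at h2
  rw [← h2]
  simp

/-- On the range of `P` the exponential is the scalar `e^c`; on the range of `1 - P` it is `1`. -/
theorem exp_smul_of_isIdempotentElem {P : Op K} (hP : IsIdempotentElem P) {c : ℂ}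
    (hc : Complex.exp c = 1) : NormedSpace.exp (c • P) = 1 := by
  have h1 : SemiconjBy P (c • P) (c • (1 : Op K)) := by
    simp [SemiconjBy, hP.eq]
  have h2 : SemiconjBy (1 - P) (c • P) (0 : Op K) := by
    simp [SemiconjBy, sub_mul, hP.eq]
  have h1 := h1.exp_right
  have h2 := h2.exp_right
  rw [exp_smul_one, hc, SemiconjBy] at h1
  rw [NormedSpace.exp_zero, SemiconjBy] at h2
  have : NormedSpace.exp (c • P) = P * NormedSpace.exp (c • P)
      + (1 - P) * NormedSpace.exp (c • P) := by noncomm_ring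
  rw [this, h1, h2]
  simp

theorem exp_sum_eq_one {ι : Type*} (s : Finset ι) (f : ι → Op K)
    (hf : ∀ i j, Commute (f i) (f j)) (h1 : ∀ i, NormedSpace.exp (f i) = 1) :
    NormedSpace.exp (∑ i ∈ s, f i) = 1 := by
  classical
  induction s using Finset.induction_on with
  | empty => simp
  | insert a s ha ih =>
    rw [Finset.sum_insert ha, NormedSpace.exp_add_of_commute
      (Commute.sum_right _ _ _ fun i _ => hf a i), h1, ih, one_mul]

theorem IsCARField.mul_star_mul (hZ : IsCARField Z) {ψ : H} (hψ : ‖ψ‖ = 1) :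
    Z ψ * star (Z ψ) * Z ψ = Z ψ := by
  have h := hZ.star_mul_eq ψ ψ
  rw [mul_assoc, h, mul_sub, ← mul_assoc, hZ.mul_self]
  simp [inner_self_eq_norm_sq_to_K, hψ]

theorem IsCARField.commute_of_inner_eq_zero (hZ : IsCARField Z) {ψ φ : H}
    (h : ⟪φ, ψ⟫_ℂ = 0) : Commute (star (Z ψ) * Z ψ) (Z φ) := by
  have := hZ.star_mul_mul_sub ψ ψ φ
  rw [h, zero_smul, neg_zero, sub_eq_zero] at this
  exact this

theorem IsCARField.commute_of_inner_eq_zero' (hZ : IsCARField Z) {ψ φ : H}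
    (h : ⟪φ, ψ⟫_ℂ = 0) : Commute (star (Z ψ) * Z ψ) (star (Z φ)) := by
  have := (hZ.commute_of_inner_eq_zero h).star_star
  simpa using this

theorem parityOp_mem_unitary (Z : H →ₗ⋆[ℂ] Op K) : parityOp Z ∈ unitary (Op K) :=
  exp_mem_unitary (by rw [numberOp, star_secondQuant, star_one]) _

theorem IsCARField.parityOp_mul (hZ : IsCARField Z) (ψ : H) :
    parityOp Z * Z ψ = -(Z ψ * parityOp Z) :=
  exp_mul_eq_neg_mul_exp (by simpa [numberOp] using hZ.secondQuant_comm 1 ψ)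

theorem IsCARField.parityOp_mul_self (hZ : IsCARField Z) : parityOp Z * parityOp Z = 1 := by
  -- `W² = e^{2πi𝒩}`, and `𝒩` is a sum of commuting idempotents `Z*(e_j)Z(e_j)`, each of which
  -- contributes a factor `1`.
  rw [parityOp, ← NormedSpace.exp_add_of_commute (Commute.refl _), ← add_smul, numberOp,
    secondQuant, Finset.smul_sum]
  refine exp_sum_eq_one _ _ (fun i j => Commute.smul_left (Commute.smul_right ?_ _) _) fun i => ?_
  · by_cases h : i = j
    · rw [h]
    · have h0 : ⟪stdOrthonormalBasis ℂ H j, stdOrthonormalBasis ℂ H i⟫_ℂ = 0 :=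
        (stdOrthonormalBasis ℂ H).orthonormal.2 (Ne.symm h)
      simpa using (hZ.commute_of_inner_eq_zero' h0).mul_right (hZ.commute_of_inner_eq_zero h0)
  · refine exp_smul_of_isIdempotentElem ?_ (by rw [Complex.exp_add, Complex.exp_pi_mul_I]; norm_num)
    have h := hZ.mul_star_mul ((stdOrthonormalBasis ℂ H).orthonormal.1 i)
    simp only [IsIdempotentElem, one_apply_eq_self]
    rw [mul_assoc, ← mul_assoc (Z _), h]

theorem IsCARField.star_parityOp (hZ : IsCARField Z) : star (parityOp Z) = parityOp Z := by
  have h := Unitary.star_mul_self_of_mem (parityOp_mem_unitary Z)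
  calc star (parityOp Z) = star (parityOp Z) * (parityOp Z * parityOp Z) := by
        rw [hZ.parityOp_mul_self, mul_one]
    _ = parityOp Z := by rw [← mul_assoc, h, one_mul]

theorem IsCARField.parityOp_mul_star (hZ : IsCARField Z) (ψ : H) :
    parityOp Z * star (Z ψ) = -(star (Z ψ) * parityOp Z) := by
  have h := congrArg star (hZ.parityOp_mul ψ)
  simp only [star_mul, star_neg, hZ.star_parityOp] at h
  rw [h, neg_neg]

/-- A self-adjoint unitary `U` on the single particle space is implemented by `exp(iπ P̂)` where
`P = (1 - U)/2`. -/
theorem IsCARField.exists_implementer (hZ : IsCARField Z) {U : Op H} (hU : star U = U)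
    (hUU : U * U = 1) :
    ∃ V ∈ unitary (Op K), ∀ ψ : H, V * Z ψ * star V = Z (U ψ) := by
  set P : Op H := (1 / 2 : ℂ) • (1 - U) with hP
  have hPs : star P = P := by
    simp [hP, star_smul, hU]
  have hUP : ∀ ψ, U (U ψ) = ψ := fun ψ => by
    simpa using congrArg (fun T : Op H => T ψ) hUU
  set V : Op K := NormedSpace.exp (((Real.pi : ℂ) * Complex.I) • secondQuant Z P) with hV
  have hVu : V ∈ unitary (Op K) := exp_mem_unitary (by rw [star_secondQuant, hPs]) _
  refine ⟨V, hVu, fun ψ => ?_⟩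
  have key : V * Z ψ = Z (U ψ) * V := by
    -- `ψ - Uψ` is fixed by `P` and `ψ + Uψ` is annihilated by it. So `V` anticommutes with the
    -- first field and commutes with the second; adding gives `V Z(ψ) = Z(Uψ) V`.
    have h1 : V * Z (ψ - U ψ) = -(Z (ψ - U ψ) * V) := by
      refine exp_mul_eq_neg_mul_exp ?_
      rw [hZ.secondQuant_comm, hPs]
      congr 2
      simp only [hP, _root_.smul_apply, _root_.sub_apply, one_apply_eq_self, map_sub,
        hUP]
      module
    have h2 : V * Z (ψ + U ψ) = Z (ψ + U ψ) * V := by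
      have h := hZ.secondQuant_comm P (ψ + U ψ)
      have h0 : star P (ψ + U ψ) = 0 := by
        rw [hPs]
        simp only [hP, _root_.smul_apply, _root_.sub_apply, one_apply_eq_self, map_add,
          hUP]
        module
      rw [h0, map_zero, neg_zero, sub_eq_zero] at h
      exact ((show Commute _ _ from h).smul_left _).exp_left
    simp only [map_sub, map_add, mul_sub, mul_add, sub_mul, add_mul] at h1 h2
    have h3 : (2 : ℂ) • (V * Z ψ) = (2 : ℂ) • (Z (U ψ) * V) := by
      have := congrArg₂ (· + ·) h1 h2
      rw [two_smul, two_smul]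
      calc _ = V * Z ψ - V * Z (U ψ) + (V * Z ψ + V * Z (U ψ)) := by abel
        _ = _ := by rw [this]; abel
    exact smul_right_injective _ (two_ne_zero' ℂ) h3
  rw [key, mul_assoc, Unitary.mul_star_self_of_mem hVu, mul_one]

theorem IsCARField.implementer_spec (hZ : IsCARField Z) {U : Op H} (hU : star U = U)
    (hUU : U * U = 1) :
    implementer Z U ∈ unitary (Op K) ∧
      ∀ ψ : H, implementer Z U * Z ψ * star (implementer Z U) = Z (U ψ) := by
  have h := hZ.exists_implementer hU hUU
  rw [implementer, dif_pos h]
  exact h.choose_spec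

end CARAlgebra
-- The normalized trace and its nondegeneracy
section Trace

theorem tau_add (A B : Op K) : tau (A + B) = tau A + tau B := by simp [tau, add_div]

theorem tau_sub (A B : Op K) : tau (A - B) = tau A - tau B := by simp [tau, sub_div]

theorem tau_smul (c : ℂ) (A : Op K) : tau (c • A) = c * tau A := by simp [tau, mul_div_assoc]

theorem tau_mul_comm (A B : Op K) : tau (A * B) = tau (B * A) := by
  simp only [tau]
  congr 1
  exact LinearMap.trace_mul_comm ℂ (A : K →ₗ[ℂ] K) (B : K →ₗ[ℂ] K)

theorem tau_one [Nontrivial K] : tau (1 : Op K) = 1 := by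
  have h : (Module.finrank ℂ K : ℂ) ≠ 0 := by exact_mod_cast Module.finrank_pos.ne'
  have h1 : LinearMap.trace ℂ K ((1 : Op K) : K →ₗ[ℂ] K) = (Module.finrank ℂ K : ℂ) :=
    LinearMap.trace_one ℂ K
  rw [tau, h1, div_self h]

theorem tau_star (A : Op K) : tau (star A) = star (tau A) := by
  simp only [tau, LinearMap.trace_eq_sum_inner _ (stdOrthonormalBasis ℂ K), star_div₀, star_sum]
  congr 1
  · refine Finset.sum_congr rfl fun i _ => ?_
    simp only [ContinuousLinearMap.coe_coe, ContinuousLinearMap.star_eq_adjoint,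
      ContinuousLinearMap.adjoint_inner_right]
    exact (inner_conj_symm _ _).symm
  · simp

theorem tau_mul_rankOne (P : Op K) (x y : K) :
    tau (P * InnerProductSpace.rankOne ℂ y x) = ⟪x, P y⟫_ℂ / (Module.finrank ℂ K : ℂ) := by
  rw [tau, ContinuousLinearMap.mul_def, InnerProductSpace.comp_rankOne,
    InnerProductSpace.trace_rankOne]

theorem eq_of_tau_star_mul_eq {P Q : Op K} (h : ∀ Y : Op K, tau (star Y * P) = tau (star Y * Q)) :
    P = Q := by
  rcases subsingleton_or_nontrivial K with hK | hK
  · exact Subsingleton.elim _ _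
  have h0 : (Module.finrank ℂ K : ℂ) ≠ 0 := by exact_mod_cast Module.finrank_pos.ne'
  refine ContinuousLinearMap.ext fun y => ext_inner_left ℂ fun x => ?_
  have := h (star (InnerProductSpace.rankOne ℂ y x))
  rw [star_star, tau_mul_comm, tau_mul_comm _ Q, tau_mul_rankOne, tau_mul_rankOne] at this
  exact (div_left_inj' h0).1 this

/-- Nondegeneracy of the trace form lets adjoints be identified from their defining property,
without returning to matrix units. -/
theorem tracialAdjoint_eq_of_forall {Φ : Op K →ₗ[ℂ] Op K'} {X : Op K'} {P : Op K}
    (h : ∀ Y : Op K, tau (star (Φ Y) * X) = tau (star Y * P)) : tracialAdjoint Φ X = P :=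
  eq_of_tau_star_mul_eq fun Y => by rw [← tau_tracialAdjoint, h]

end Trace

/-! ### Tensor products, partial trace, and the doubled field -/

section Tensor

/-- The tensor product of two operators. -/
def tensorOp (A B : Op K) : Op (K ⊗[ℂ] K) := mapL A B

theorem tensorOp_add_left (A A' B : Op K) :
    tensorOp (A + A') B = tensorOp A B + tensorOp A' B := mapL_add_left A A' B

theorem tensorOp_add_right (A B B' : Op K) :
    tensorOp A (B + B') = tensorOp A B + tensorOp A B' := mapL_add_right A B B'

theorem tensorOp_smul_left (c : ℂ) (A B : Op K) : tensorOp (c • A) B = c • tensorOp A B :=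
  mapL_smul_left c A B

theorem tensorOp_smul_right (c : ℂ) (A B : Op K) : tensorOp A (c • B) = c • tensorOp A B :=
  mapL_smul_right c A B

theorem tensorOp_mul (A A' B B' : Op K) :
    tensorOp (A * A') (B * B') = tensorOp A B * tensorOp A' B' := mapL_mul A A' B B'

theorem tensorOp_one_one : tensorOp (1 : Op K) 1 = 1 := mapL_id_id

theorem star_tensorOp (A B : Op K) : star (tensorOp A B) = tensorOp (star A) (star B) :=
  adjoint_mapL A B

theorem norm_tensorOp_le (A B : Op K) : ‖tensorOp A B‖ ≤ ‖A‖ * ‖B‖ := norm_mapL_le A B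

theorem tensorOp_zero_left (B : Op K) : tensorOp 0 B = 0 := mapL_zero_left B

theorem tensorOp_zero_right (A : Op K) : tensorOp A 0 = 0 := mapL_zero_right A

theorem tensorOp_neg_right (A B : Op K) : tensorOp A (-B) = -tensorOp A B :=
  eq_neg_of_add_eq_zero_left (by rw [← tensorOp_add_right, neg_add_cancel, tensorOp_zero_right])

theorem tau_tensorOp (A B : Op K) : tau (tensorOp A B) = tau A * tau B := by
  have h : LinearMap.trace ℂ (K ⊗[ℂ] K) (tensorOp A B : K ⊗[ℂ] K →ₗ[ℂ] K ⊗[ℂ] K)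
      = LinearMap.trace ℂ K (A : K →ₗ[ℂ] K) * LinearMap.trace ℂ K (B : K →ₗ[ℂ] K) := by
    rw [tensorOp, toLinearMap_mapL]
    exact LinearMap.trace_tensorProduct' _ _
  simp only [tau, h, Module.finrank_tensorProduct, Nat.cast_mul]
  rw [mul_div_mul_comm]

theorem embedRight_apply (Y : Op K) : embedRight Y = tensorOp (1 : Op K) Y := rfl

theorem embedRight_mul (X Y : Op K) : embedRight (X * Y) = embedRight X * embedRight Y := by
  simp only [embedRight_apply, ← tensorOp_mul, mul_one]

theorem embedRight_one : embedRight (1 : Op K) = 1 := tensorOp_one_one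

theorem star_embedRight (X : Op K) : star (embedRight X) = embedRight (star X) := by
  simp only [embedRight_apply, star_tensorOp, star_one]

/-- The normalized partial trace over the first tensor factor. -/
def partialTrace : Op (K ⊗[ℂ] K) →ₗ[ℂ] Op K := tracialAdjoint embedRight

theorem tau_star_mul_partialTrace (Y : Op K) (X : Op (K ⊗[ℂ] K)) :
    tau (star Y * partialTrace X) = tau (star (embedRight Y) * X) :=
  (tau_tracialAdjoint _ _ _).symm

theorem partialTrace_tensorOp (A B : Op K) : partialTrace (tensorOp A B) = tau A • B :=
  tracialAdjoint_eq_of_forall fun Y => by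
    rw [star_embedRight, embedRight_apply, ← tensorOp_mul, one_mul, tau_tensorOp, mul_smul_comm, tau_smul]

/-- The adjoint of a `*`-homomorphism is a bimodule map over its image: the factor `B` is moved onto
the test operator and back. -/
theorem partialTrace_embedRight_mul (B : Op K) (X : Op (K ⊗[ℂ] K)) :
    partialTrace (embedRight B * X) = B * partialTrace X :=
  tracialAdjoint_eq_of_forall fun Y => by
    have h := tau_star_mul_partialTrace (star B * Y) X
    rw [star_mul, star_star, mul_assoc] at h
    rw [h, star_embedRight, star_embedRight, star_mul, star_star, embedRight_mul, mul_assoc]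

theorem partialTrace_mul_embedRight (B : Op K) (X : Op (K ⊗[ℂ] K)) :
    partialTrace (X * embedRight B) = partialTrace X * B :=
  tracialAdjoint_eq_of_forall fun Y => by
    have h := tau_star_mul_partialTrace (Y * star B) X
    rw [star_mul, star_star, mul_assoc] at h
    rw [← mul_assoc, tau_mul_comm, ← mul_assoc, ← mul_assoc, tau_mul_comm _ B, h, star_embedRight,
      star_embedRight, star_mul, star_star, embedRight_mul]

variable {Z : H →ₗ⋆[ℂ] Op K}

theorem doubled_apply (Z : H →ₗ⋆[ℂ] Op K) (ξ : WithLp 2 (H × H)) :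
    doubled Z ξ = tensorOp (Z ξ.fst) (parityOp Z) + tensorOp 1 (Z ξ.snd) := rfl

/-- The field `Z(ψ ⊕ η) = Z(ψ) ⊗ W + 1 ⊗ Z(η)` as a conjugate linear map. -/
def doubledField (Z : H →ₗ⋆[ℂ] Op K) : WithLp 2 (H × H) →ₗ⋆[ℂ] Op (K ⊗[ℂ] K) where
  toFun := doubled Z
  map_add' ξ ξ' := by
    simp only [doubled_apply, WithLp.add_fst, WithLp.add_snd, map_add, tensorOp_add_left, tensorOp_add_right]
    abel
  map_smul' c ξ := by
    simp only [doubled_apply, WithLp.smul_fst, WithLp.smul_snd, LinearMap.map_smulₛₗ, tensorOp_smul_left,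
      tensorOp_smul_right, smul_add]

theorem coe_doubledField (Z : H →ₗ⋆[ℂ] Op K) : ⇑(doubledField Z) = doubled Z := rfl

/-- Since `W` anticommutes with the right fields, the cross terms between the two summands cancel;
`W² = 1` reduces the diagonal terms to the relations of `Z`. -/
theorem IsCARField.doubledField (hZ : IsCARField Z) : IsCARField (doubledField Z) where
  anticomm_star ξ ξ' := by
    simp only [coe_doubledField, doubled_apply, star_add, star_tensorOp, hZ.star_parityOp, star_one, mul_add,
      add_mul, ← tensorOp_mul, hZ.parityOp_mul_self, one_mul, mul_one, hZ.parityOp_mul_star,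
      hZ.parityOp_mul, tensorOp_neg_right]
    have h1 := congrArg (fun X => tensorOp X (1 : Op K)) (hZ.anticomm_star ξ.fst ξ'.fst)
    have h2 := congrArg (fun X => tensorOp (1 : Op K) X) (hZ.anticomm_star ξ.snd ξ'.snd)
    simp only [tensorOp_add_left, tensorOp_add_right, tensorOp_smul_left, tensorOp_smul_right, tensorOp_one_one]
      at h1 h2
    have h3 : ⟪ξ, ξ'⟫_ℂ • (1 : Op (K ⊗[ℂ] K)) = ⟪ξ.fst, ξ'.fst⟫_ℂ • (1 : Op (K ⊗[ℂ] K))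
        + ⟪ξ.snd, ξ'.snd⟫_ℂ • (1 : Op (K ⊗[ℂ] K)) := by
      rw [← tensorOp_one_one, ← tensorOp_smul_left, ← tensorOp_smul_left, ← tensorOp_smul_left,
        ← tensorOp_add_left, ← add_smul, WithLp.prod_inner_apply]
      rfl
    rw [h3, ← h1, ← h2]
    abel
  anticomm ξ ξ' := by
    simp only [coe_doubledField, doubled_apply, mul_add,
      add_mul, ← tensorOp_mul, hZ.parityOp_mul_self, one_mul, mul_one,
      hZ.parityOp_mul, tensorOp_neg_right]
    have h1 := congrArg (fun X => tensorOp X (1 : Op K)) (hZ.anticomm ξ.fst ξ'.fst)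
    have h2 := congrArg (fun X => tensorOp (1 : Op K) X) (hZ.anticomm ξ.snd ξ'.snd)
    simp only [tensorOp_add_left, tensorOp_add_right, tensorOp_zero_left, tensorOp_zero_right] at h1 h2
    have : ∀ a b c d e f : Op (K ⊗[ℂ] K), a + d = 0 → c + f = 0 →
        a + b + (-e + c) + (d + e + (-b + f)) = 0 := by
      intro a b c d e f h1 h2
      calc _ = (a + d) + (c + f) := by abel
        _ = 0 := by rw [h1, h2, add_zero]
    exact this _ _ _ _ _ _ h1 h2

theorem embedLeft_apply (Z : H →ₗ⋆[ℂ] Op K) (X : Op K) : embedLeft Z X =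
    tensorOp ((1 / 2 : ℂ) • (X + parityOp Z * X * parityOp Z)) (1 : Op K)
      + tensorOp ((1 / 2 : ℂ) • (X - parityOp Z * X * parityOp Z)) (parityOp Z) := rfl

theorem IsCARField.parity_conj_mul (hZ : IsCARField Z) (X Y : Op K) :
    parityOp Z * (X * Y) * parityOp Z
      = (parityOp Z * X * parityOp Z) * (parityOp Z * Y * parityOp Z) := by
  calc _ = parityOp Z * X * (parityOp Z * parityOp Z) * Y * parityOp Z := by
        rw [hZ.parityOp_mul_self]; noncomm_ring
    _ = _ := by noncomm_ring

theorem IsCARField.parity_conj_field (hZ : IsCARField Z) (ψ : H) :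
    parityOp Z * Z ψ * parityOp Z = -Z ψ := by
  rw [hZ.parityOp_mul, neg_mul, mul_assoc, hZ.parityOp_mul_self, mul_one]

theorem IsCARField.parity_conj_star_field (hZ : IsCARField Z) (ψ : H) :
    parityOp Z * star (Z ψ) * parityOp Z = -star (Z ψ) := by
  rw [hZ.parityOp_mul_star, neg_mul, mul_assoc, hZ.parityOp_mul_self, mul_one]

/-- Parity conjugation is multiplicative, so even and odd parts multiply as in a `ℤ/2`-graded
algebra, and `W² = 1` makes odd times odd land in the summand `· ⊗ 1`. -/
theorem IsCARField.embedLeft_mul (hZ : IsCARField Z) (X Y : Op K) :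
    embedLeft Z (X * Y) = embedLeft Z X * embedLeft Z Y := by
  simp only [embedLeft_apply, hZ.parity_conj_mul, add_mul, mul_add, ← tensorOp_mul,
    hZ.parityOp_mul_self, one_mul, mul_one]
  rw [show ∀ a b c d : Op (K ⊗[ℂ] K), a + c + (b + d) = (a + d) + (c + b) from
    fun a b c d => by abel, ← tensorOp_add_left, ← tensorOp_add_left]
  congr 2 <;>
  · simp only [smul_mul_assoc, mul_smul_comm, ← smul_add, smul_smul, mul_add, mul_sub, add_mul,
      sub_mul]
    module

theorem IsCARField.embedLeft_one (hZ : IsCARField Z) : embedLeft Z 1 = 1 := by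
  rw [embedLeft_apply, mul_one, hZ.parityOp_mul_self, sub_self, smul_zero, tensorOp_zero_left,
    add_zero, ← two_smul ℂ, smul_smul]
  norm_num [tensorOp_one_one]

theorem IsCARField.star_embedLeft (hZ : IsCARField Z) (X : Op K) :
    star (embedLeft Z X) = embedLeft Z (star X) := by
  simp only [embedLeft_apply, star_add, star_tensorOp, star_smul, star_sub, star_mul, hZ.star_parityOp,
    star_one, mul_assoc]
  simp

theorem IsCARField.embedLeft_field (hZ : IsCARField Z) (ψ : H) :
    embedLeft Z (Z ψ) = doubled Z (WithLp.toLp 2 (ψ, 0)) := by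
  simp only [embedLeft_apply, doubled_apply, hZ.parity_conj_field,
    add_neg_cancel, smul_zero, tensorOp_zero_left, zero_add, sub_neg_eq_add, ← two_smul ℂ, smul_smul]
  norm_num [tensorOp_zero_right]

theorem condExpLeft_tau (Z : H →ₗ⋆[ℂ] Op K) (B : Op K) (Y : Op (K ⊗[ℂ] K)) :
    tau (star (condExpLeft Z Y) * B) = tau (star Y * embedLeft Z B) := by
  have h := tau_tracialAdjoint (embedLeft Z) B Y
  have h2 := congrArg star h
  rw [← tau_star, ← tau_star] at h2
  simp only [star_mul, star_star] at h2
  exact h2.symm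

/-- The dual operation in the Heisenberg picture: apply the automorphism implemented by `V` to the
left copy, weight with the density and take the partial trace. -/
theorem ehkDual_apply (Z : H →ₗ⋆[ℂ] Op K) (S R : Op H) (X : Op K) :
    ehkDual Z S R X = partialTrace
      (star (gaussianDensity (fun ψ : H => doubled Z (WithLp.toLp 2 (ψ, 0))) (ancillaSymbol S R)) *
        (implementer (doubled Z) (dilation S) * embedLeft Z X *
          star (implementer (doubled Z) (dilation S)))) :=
  tracialAdjoint_eq_of_forall fun Y => by
    rw [tau_star_mul_partialTrace]
    simp only [ehk, LinearMap.comp_apply, LinearMap.mulLeft_apply, LinearMap.mulRight_apply]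
    rw [condExpLeft_tau]
    simp only [star_mul, star_star, mul_assoc]
    rw [tau_mul_comm]
    simp only [mul_assoc]

end Tensor
-- Gaussian densities and their one- and two-point functions
section Gaussian

variable {Z : H →ₗ⋆[ℂ] Op K}

/-- The factor of a Gaussian density belonging to a single mode. -/
def modeFactor (Z : H → Op K) (μ : ℝ) (ψ : H) : Op K :=
  (((1 - μ : ℝ) : ℂ) * 2) • (Z ψ * star (Z ψ)) + ((μ : ℂ) * 2) • (star (Z ψ) * Z ψ)

/-- The product of the mode factors along a list of indices. -/
def modeProd {ι : Type*} (Z : H → Op K) (μ : ι → ℝ) (e : ι → H) (l : List ι) : Op K :=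
  (l.map fun j => modeFactor Z (μ j) (e j)).prod

theorem modeProd_cons {ι : Type*} (Z : H → Op K) (μ : ι → ℝ) (e : ι → H) (a : ι) (l : List ι) :
    modeProd Z μ e (a :: l) = modeFactor Z (μ a) (e a) * modeProd Z μ e l := by
  simp [modeProd]

theorem gaussianDensity_eq (Z : H → Op K) {Q : Op H} (hQ : (Q : H →ₗ[ℂ] H).IsSymmetric) :
    gaussianDensity Z Q = modeProd Z (hQ.eigenvalues rfl) (hQ.eigenvectorBasis rfl)
      (List.finRange _) := by
  rw [gaussianDensity, dif_pos hQ, modeProd, List.ofFn_eq_map]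
  rfl

theorem IsCARField.commute_modeFactor (hZ : IsCARField Z) (μ : ℝ) {ψ φ : H} (h : ⟪φ, ψ⟫_ℂ = 0) :
    Commute (modeFactor Z μ ψ) (Z φ) := by
  have h1 := hZ.commute_of_inner_eq_zero h
  have h2 : Z ψ * star (Z ψ) = ⟪ψ, ψ⟫_ℂ • (1 : Op K) - star (Z ψ) * Z ψ :=
    eq_sub_of_add_eq (hZ.anticomm_star ψ ψ)
  rw [modeFactor, h2]
  exact ((((Commute.one_left _).smul_left _).sub_left h1).smul_left _).add_left (h1.smul_left _)

theorem star_modeFactor (Z : H → Op K) (μ : ℝ) (ψ : H) :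
    star (modeFactor Z μ ψ) = modeFactor Z μ ψ := by
  simp [modeFactor, star_smul]

theorem IsCARField.commute_modeFactor_star (hZ : IsCARField Z) (μ : ℝ) {ψ φ : H}
    (h : ⟪φ, ψ⟫_ℂ = 0) : Commute (modeFactor Z μ ψ) (star (Z φ)) := by
  have := (hZ.commute_modeFactor μ h).star_star
  rwa [star_modeFactor] at this

theorem IsCARField.commute_modeProd (hZ : IsCARField Z) {ι : Type*} (μ : ι → ℝ) {e : ι → H}
    (he : Orthonormal ℂ e) {a : ι} {l : List ι} (ha : a ∉ l) :
    Commute (modeProd Z μ e l) (Z (e a)) := by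
  refine Commute.list_prod_left _ _ fun x hx => ?_
  obtain ⟨j, hj, rfl⟩ := List.mem_map.1 hx
  exact hZ.commute_modeFactor _ (he.2 fun h => ha (h ▸ hj))

theorem IsCARField.commute_modeProd_star (hZ : IsCARField Z) {ι : Type*} (μ : ι → ℝ) {e : ι → H}
    (he : Orthonormal ℂ e) {a : ι} {l : List ι} (ha : a ∉ l) :
    Commute (modeProd Z μ e l) (star (Z (e a))) := by
  refine Commute.list_prod_left _ _ fun x hx => ?_
  obtain ⟨j, hj, rfl⟩ := List.mem_map.1 hx
  exact hZ.commute_modeFactor_star _ (he.2 fun h => ha (h ▸ hj))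

/-- The remaining factors commute with the mode, so by cyclicity `ZZ*` and `Z*Z` have equal weighted
traces, each one half; the weights `2(1 - μ)` and `2μ` then give `1`. -/
theorem IsCARField.tau_modeProd [Nontrivial K] (hZ : IsCARField Z) {ι : Type*} (μ : ι → ℝ)
    {e : ι → H} (he : Orthonormal ℂ e) {l : List ι} (hl : l.Nodup) :
    tau (modeProd Z μ e l) = 1 := by
  induction l with
  | nil => simp [modeProd, tau_one]
  | cons a l ih =>
    obtain ⟨ha, hl⟩ := List.nodup_cons.1 hl
    have h1 := hZ.commute_modeProd_star μ he ha
    set P := modeProd Z μ e l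
    have h2 : tau (Z (e a) * star (Z (e a)) * P) = tau (star (Z (e a)) * Z (e a) * P) := by
      rw [mul_assoc, tau_mul_comm, ← h1.eq, mul_assoc, tau_mul_comm]
    have h3 : tau (Z (e a) * star (Z (e a)) * P) + tau (star (Z (e a)) * Z (e a) * P) = 1 := by
      rw [← tau_add, ← add_mul, hZ.anticomm_star, inner_self_eq_norm_sq_to_K, he.1 a]
      simpa using ih hl
    rw [modeProd_cons, modeFactor, add_mul, tau_add, smul_mul_assoc, smul_mul_assoc, tau_smul,
      tau_smul, h2]
    rw [h2] at h3
    push_cast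
    linear_combination h3

/-- A KMS-type exchange relation: `Z` times its mode factor is `2μZ`, and in the other order it is
`2(1 - μ)Z`. The form without division covers `μ = 0` and `μ = 1`. -/
theorem IsCARField.modeProd_mul (hZ : IsCARField Z) {ι : Type*} (μ : ι → ℝ)
    {e : ι → H} (he : Orthonormal ℂ e) {l : List ι} (hl : l.Nodup) {a : ι} (ha : a ∈ l) :
    (1 - (μ a : ℂ)) • (Z (e a) * modeProd Z μ e l) = (μ a : ℂ) • (modeProd Z μ e l * Z (e a)) := by
  induction l with
  | nil => simp at ha
  | cons b l ih =>
    obtain ⟨hb, hl⟩ := List.nodup_cons.1 hl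
    rw [modeProd_cons]
    by_cases hab : a = b
    · subst hab
      have h1 := hZ.commute_modeProd μ he hb
      have h2 : Z (e a) * modeFactor Z (μ a) (e a) = ((μ a : ℂ) * 2) • Z (e a) := by
        rw [modeFactor, mul_add, mul_smul_comm, mul_smul_comm, ← mul_assoc, ← mul_assoc,
          hZ.mul_self, hZ.mul_star_mul (he.1 a)]
        simp
      have h3 : modeFactor Z (μ a) (e a) * Z (e a) = ((1 - (μ a : ℂ)) * 2) • Z (e a) := by
        rw [modeFactor, add_mul, smul_mul_assoc, smul_mul_assoc, mul_assoc (star _),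
          hZ.mul_self, hZ.mul_star_mul (he.1 a)]
        simp
      rw [← mul_assoc, h2, mul_assoc, h1.eq, ← mul_assoc, h3]
      simp only [smul_mul_assoc, smul_smul]
      congr 1
      ring
    · have h1 := hZ.commute_modeFactor (μ b) (he.2 hab)
      have h := ih hl (List.mem_of_ne_of_mem hab ha)
      rw [← mul_assoc, ← h1.eq, mul_assoc, ← mul_smul_comm, h, mul_smul_comm, ← mul_assoc]

theorem IsCARField.commute_numberOp_modeFactor (hZ : IsCARField Z) (μ : ℝ) (ψ : H) :
    Commute (modeFactor Z μ ψ) (numberOp Z) := by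
  have h1 : numberOp Z * Z ψ = Z ψ * numberOp Z - Z ψ := by
    have h := hZ.secondQuant_comm 1 ψ
    rw [star_one, one_apply_eq_self, sub_eq_iff_eq_add] at h
    rw [numberOp, h]
    abel
  have hs : star (numberOp Z) = numberOp Z := by rw [numberOp, star_secondQuant, star_one]
  have h2 : numberOp Z * star (Z ψ) = star (Z ψ) * numberOp Z + star (Z ψ) := by
    have h := congrArg star h1
    simp only [star_mul, star_sub, hs] at h
    rw [h]
    abel
  have h3 : Commute (Z ψ * star (Z ψ)) (numberOp Z) := by
    rw [Commute, SemiconjBy, ← mul_assoc, h1, sub_mul, mul_assoc _ _ (star _), h2]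
    noncomm_ring
  have h4 : Commute (star (Z ψ) * Z ψ) (numberOp Z) := by
    rw [Commute, SemiconjBy, ← mul_assoc, h2, add_mul, mul_assoc _ _ (Z ψ), h1]
    noncomm_ring
  exact (h3.smul_left _).add_left (h4.smul_left _)

/-- Gauge invariance: an operator that changes the particle number by a nonzero amount then has zero
expectation, by cyclicity of the trace. -/
theorem IsCARField.commute_numberOp_modeProd (hZ : IsCARField Z) {ι : Type*} (μ : ι → ℝ)
    (e : ι → H) (l : List ι) : Commute (modeProd Z μ e l) (numberOp Z) := by
  refine Commute.list_prod_left _ _ fun x hx => ?_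
  obtain ⟨j, hj, rfl⟩ := List.mem_map.1 hx
  exact hZ.commute_numberOp_modeFactor _ _

/-- Gauge invariance: two annihilation operators have vanishing expectation. -/
theorem IsCARField.tau_gaussianDensity_mul_mul (hZ : IsCARField Z) {Q : Op H}
    (hQ : (Q : H →ₗ[ℂ] H).IsSymmetric) (ψ φ : H) :
    tau (gaussianDensity Z Q * (Z ψ * Z φ)) = 0 := by
  have hc := hZ.commute_numberOp_modeProd (hQ.eigenvalues rfl) (hQ.eigenvectorBasis rfl)
    (List.finRange _)
  rw [← gaussianDensity_eq] at hc
  have h1 : ∀ ψ, numberOp Z * Z ψ = Z ψ * numberOp Z - Z ψ := fun ψ => by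
    have h := hZ.secondQuant_comm 1 ψ
    rw [star_one, one_apply_eq_self, sub_eq_iff_eq_add] at h
    rw [numberOp, h]
    abel
  have h2 : numberOp Z * (Z ψ * Z φ) = Z ψ * Z φ * numberOp Z - (2 : ℂ) • (Z ψ * Z φ) := by
    rw [← mul_assoc, h1, sub_mul, mul_assoc, h1, two_smul]
    noncomm_ring
  have h3 : tau (gaussianDensity Z Q * (numberOp Z * (Z ψ * Z φ)))
      = tau (gaussianDensity Z Q * (Z ψ * Z φ * numberOp Z)) := by
    rw [← mul_assoc, hc.eq, mul_assoc, tau_mul_comm, mul_assoc]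
  rw [h2, mul_sub, tau_sub, mul_smul_comm, tau_smul] at h3
  linear_combination (-1 / 2 : ℂ) * h3

theorem IsCARField.tau_gaussianDensity [Nontrivial K] (hZ : IsCARField Z) {Q : Op H}
    (hQ : (Q : H →ₗ[ℂ] H).IsSymmetric) : tau (gaussianDensity Z Q) = 1 := by
  rw [gaussianDensity_eq Z hQ]
  exact hZ.tau_modeProd _ (hQ.eigenvectorBasis rfl).orthonormal (List.nodup_finRange _)

/-- The two-point function of a gauge invariant Gaussian state. -/
theorem IsCARField.tau_gaussianDensity_mul_star [Nontrivial K] (hZ : IsCARField Z) {Q : Op H}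
    (hQ : (Q : H →ₗ[ℂ] H).IsSymmetric) (ψ φ : H) :
    tau (gaussianDensity Z Q * (Z ψ * star (Z φ))) = ⟪ψ, φ⟫_ℂ - ⟪ψ, Q φ⟫_ℂ := by
  set e := hQ.eigenvectorBasis rfl with he
  set μ := hQ.eigenvalues rfl with hμ
  set ρ := gaussianDensity Z Q with hρ
  have hρ1 : tau ρ = 1 := hZ.tau_gaussianDensity hQ
  have h1 : ∀ a b, tau (ρ * (Z (e a) * star (Z (e b)))) = (1 - (μ a : ℂ)) * ⟪e a, e b⟫_ℂ := by
    intro a b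
    -- With `x` the two-point function, the exchange relation, cyclicity and the CAR give `(1 -
    -- μ_a)(⟪e_a, e_b⟫ - x) = μ_a x`, which is linear in `x`.
    have hm := hZ.modeProd_mul μ e.orthonormal (List.nodup_finRange _) (List.mem_finRange a)
    rw [← gaussianDensity_eq Z hQ] at hm
    have h2 := congrArg (fun X => tau (X * star (Z (e b)))) hm
    simp only [smul_mul_assoc, tau_smul] at h2
    rw [mul_assoc, tau_mul_comm, mul_assoc, hZ.star_mul_eq, mul_sub, tau_sub, mul_smul_comm,
      mul_one, tau_smul, hρ1, mul_assoc] at h2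
    linear_combination -h2
  have h2 : tau (ρ * (Z ψ * star (Z φ))) = ∑ a, ∑ b, ⟪ψ, e a⟫_ℂ * ⟪e b, φ⟫_ℂ *
      tau (ρ * (Z (e a) * star (Z (e b)))) := by
    rw [map_eq_sum_inner e Z ψ, star_map_eq_sum_inner e Z φ]
    simp only [tau, Finset.sum_mul, Finset.mul_sum, smul_mul_assoc, mul_smul_comm,
      ContinuousLinearMap.toLinearMap_sum, ContinuousLinearMap.toLinearMap_smul, map_sum, map_smul,
      Finset.sum_div, smul_eq_mul]
    rw [Finset.sum_comm]
    refine Finset.sum_congr rfl fun a _ => Finset.sum_congr rfl fun b _ => ?_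
    ring
  have h3 : ∀ a, ⟪e a, Q φ⟫_ℂ = (μ a : ℂ) * ⟪e a, φ⟫_ℂ := fun a => by
    have h4 : Q (e a) = (μ a : ℂ) • e a := hQ.apply_eigenvectorBasis rfl a
    have h5 : ⟪Q (e a), φ⟫_ℂ = ⟪e a, Q φ⟫_ℂ := hQ (e a) φ
    rw [← h5, h4, inner_smul_left]
    simp
  rw [h2, ← e.sum_inner_mul_inner ψ φ, ← e.sum_inner_mul_inner ψ (Q φ), ← Finset.sum_sub_distrib]
  refine Finset.sum_congr rfl fun a _ => ?_
  simp only [h1, h3, OrthonormalBasis.inner_eq_ite, mul_ite, mul_one, mul_zero,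
    Finset.sum_ite_eq, Finset.mem_univ, if_true]
  ring

theorem exists_norm_le (Z : H →ₗ⋆[ℂ] Op K) : ∃ C : ℝ, 0 ≤ C ∧ ∀ ψ, ‖Z ψ‖ ≤ C * ‖ψ‖ := by
  refine ⟨∑ j, ‖Z (stdOrthonormalBasis ℂ H j)‖, Finset.sum_nonneg fun _ _ => norm_nonneg _,
    fun ψ => ?_⟩
  rw [map_eq_sum_inner (stdOrthonormalBasis ℂ H) Z ψ, Finset.sum_mul]
  refine (norm_sum_le _ _).trans (Finset.sum_le_sum fun j _ => ?_)
  rw [norm_smul, mul_comm]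
  gcongr
  simpa using norm_inner_le_norm (𝕜 := ℂ) ψ (stdOrthonormalBasis ℂ H j)

-- The bound is uniform over the symbols because all occupation numbers lie in `[0,1]`. Uniformity
-- matters: the ancilla symbol varies with `t` and is not shown to converge.
open scoped ComplexOrder in
theorem exists_norm_gaussianDensity_le (Z : H →ₗ⋆[ℂ] Op K) :
    ∃ C : ℝ, ∀ Q : Op H, 0 ≤ Q → Q ≤ 1 → ‖gaussianDensity Z Q‖ ≤ C := by
  obtain ⟨C, hC0, hC⟩ := exists_norm_le Z
  refine ⟨(4 * C ^ 2) ^ Module.finrank ℂ H * ‖(1 : Op K)‖, fun Q h0 h1 => ?_⟩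
  have hQ : (Q : H →ₗ[ℂ] H).IsSymmetric :=
    ((ContinuousLinearMap.nonneg_iff_isPositive Q).1 h0).isSymmetric
  set e := hQ.eigenvectorBasis rfl with he
  set μ := hQ.eigenvalues rfl with hμ
  have hin : ∀ j, ⟪e j, Q (e j)⟫_ℂ = (μ j : ℂ) := fun j => by
    have h4 : Q (e j) = (μ j : ℂ) • e j := hQ.apply_eigenvectorBasis rfl j
    rw [h4, inner_smul_right, inner_self_eq_norm_sq_to_K, e.orthonormal.1 j]
    simp
  have hμ0 : ∀ j, 0 ≤ μ j := fun j => by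
    have := ((ContinuousLinearMap.nonneg_iff_isPositive Q).1 h0).inner_nonneg_right (e j)
    rw [hin] at this
    exact_mod_cast this
  have hμ1 : ∀ j, μ j ≤ 1 := fun j => by
    have := ((ContinuousLinearMap.le_def _ _).1 h1).inner_nonneg_right (e j)
    rw [_root_.sub_apply, inner_sub_right, hin, one_apply_eq_self, inner_self_eq_norm_sq_to_K,
      e.orthonormal.1 j] at this
    have h2 : (0 : ℂ) ≤ ((1 - μ j : ℝ) : ℂ) := by simpa using this
    have h3 : 0 ≤ 1 - μ j := by exact_mod_cast h2
    linarith
  have hf : ∀ j, ‖modeFactor Z (μ j) (e j)‖ ≤ 4 * C ^ 2 := fun j => by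
    have hz : ‖Z (e j)‖ ≤ C := by simpa [e.orthonormal.1 j] using hC (e j)
    have hzz : ‖Z (e j)‖ * ‖Z (e j)‖ ≤ C ^ 2 := by rw [sq]; gcongr
    have a1 : ‖Z (e j) * star (Z (e j))‖ ≤ C ^ 2 :=
      (norm_mul_le _ _).trans (by rw [norm_star]; exact hzz)
    have a2 : ‖star (Z (e j)) * Z (e j)‖ ≤ C ^ 2 :=
      (norm_mul_le _ _).trans (by rw [norm_star]; exact hzz)
    refine (norm_add_le _ _).trans ?_
    rw [norm_smul, norm_smul, norm_mul (_ : ℂ), norm_mul (_ : ℂ), Complex.norm_real, Complex.norm_real,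
      Real.norm_of_nonneg (hμ0 j), Real.norm_of_nonneg (sub_nonneg.2 (hμ1 j))]
    have b1 : (1 - μ j) * ‖(2 : ℂ)‖ ≤ 2 := by norm_num; linarith [hμ0 j]
    have b2 : μ j * ‖(2 : ℂ)‖ ≤ 2 := by norm_num; linarith [hμ1 j]
    calc _ ≤ 2 * C ^ 2 + 2 * C ^ 2 := by gcongr
      _ = 4 * C ^ 2 := by ring
  have hl : ∀ l : List (Fin (Module.finrank ℂ H)),
      ‖modeProd Z μ e l‖ ≤ (4 * C ^ 2) ^ l.length * ‖(1 : Op K)‖ := by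
    intro l
    induction l with
    | nil => simp [modeProd]
    | cons a l ih =>
      rw [modeProd_cons, List.length_cons, pow_succ']
      refine (norm_mul_le _ _).trans ?_
      rw [mul_assoc]
      exact mul_le_mul (hf a) ih (norm_nonneg _) (by positivity)
  rw [gaussianDensity_eq Z hQ]
  simpa using hl (List.finRange _)

theorem doubled_left (Z : H →ₗ⋆[ℂ] Op K) (ψ : H) :
    doubled Z (WithLp.toLp 2 (ψ, 0)) = tensorOp (Z ψ) (parityOp Z) := by
  rw [doubled_apply]
  simp [tensorOp_zero_right]

/-- Each factor is quadratic in the left fields, so the two copies of `W` cancel and the density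
sits in the first tensor factor alone. -/
theorem IsCARField.gaussianDensity_doubled (hZ : IsCARField Z) {Q : Op H}
    (hQ : (Q : H →ₗ[ℂ] H).IsSymmetric) :
    gaussianDensity (fun ψ : H => doubled Z (WithLp.toLp 2 (ψ, 0))) Q
      = tensorOp (gaussianDensity Z Q) 1 := by
  have h1 : ∀ μ ψ, modeFactor (fun ψ : H => doubled Z (WithLp.toLp 2 (ψ, 0))) μ ψ
      = tensorOp (modeFactor Z μ ψ) 1 := fun μ ψ => by
    simp only [modeFactor, doubled_left, star_tensorOp, ← tensorOp_mul, hZ.star_parityOp,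
      hZ.parityOp_mul_self, tensorOp_add_left, tensorOp_smul_left]
  rw [gaussianDensity_eq _ hQ, gaussianDensity_eq _ hQ]
  induction List.finRange (Module.finrank ℂ H) with
  | nil => simp [modeProd, tensorOp_one_one]
  | cons a l ih => rw [modeProd_cons, modeProd_cons, h1, ih, ← tensorOp_mul, one_mul]

end Gaussian
-- Functional calculus, Moore–Penrose quotients, and the unitary dilation
section FunctionalCalculus

/-- Spectral values are roots of the minimal polynomial. Finiteness makes every real function
continuous on the spectrum, in particular the discontinuous `x ↦ (√x)⁻¹`. -/
theorem finite_real_spectrum (a : Op H) : (spectrum ℝ a).Finite := by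
  have hint : IsIntegral ℂ a := Algebra.IsIntegral.isIntegral a
  have hne : minpoly ℂ a ≠ 0 := minpoly.ne_zero hint
  have hfin : (spectrum ℂ a).Finite := by
    refine (minpoly ℂ a).roots.toFinset.finite_toSet.subset fun r hr => ?_
    have h := spectrum.subset_polynomial_aeval a (minpoly ℂ a) ⟨r, hr, rfl⟩
    rw [minpoly.aeval] at h
    have h0 : (minpoly ℂ a).eval r = 0 := by
      rcases subsingleton_or_nontrivial (Op H) with hs | hs
      · simp [spectrum.of_subsingleton] at h
      · simpa using h
    simp [hne, h0]
  exact (hfin.preimage (FaithfulSMul.algebraMap_injective ℝ ℂ).injOn).subset fun r hr => by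
    exact hr

theorem continuousOn_real_spectrum (f : ℝ → ℝ) (a : Op H) : ContinuousOn f (spectrum ℝ a) :=
  (finite_real_spectrum a).continuousOn f

/-- An intertwiner of two self-adjoint operators intertwines all their functions. -/
theorem semiconjBy_cfc {S a b : Op H} (ha : IsSelfAdjoint a) (hb : IsSelfAdjoint b)
    (h : SemiconjBy S a b) (f : ℝ → ℝ) : SemiconjBy S (cfc f a) (cfc f b) := by
  classical
  set s := (finite_real_spectrum a).toFinset ∪ (finite_real_spectrum b).toFinset with hs
  -- A single polynomial interpolates `f` on both spectra at once, which reduces the claim to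
  -- powers.
  set p : Polynomial ℝ := Lagrange.interpolate s id f with hp
  have hpf : ∀ x ∈ s, p.eval x = f x := fun x hx =>
    Lagrange.eval_interpolate_at_node f Function.injective_id.injOn hx
  have h1 : cfc f a = Polynomial.aeval a p := by
    rw [← cfc_polynomial p a ha]
    exact cfc_congr fun x hx => (hpf x (by simp [hs, hx])).symm
  have h2 : cfc f b = Polynomial.aeval b p := by
    rw [← cfc_polynomial p b hb]
    exact cfc_congr fun x hx => (hpf x (by simp [hs, hx])).symm
  rw [h1, h2]
  induction p using Polynomial.induction_on' with
  | add p q hp hq => simpa only [map_add] using hp.add_right hq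
  | monomial n c =>
    simp only [Polynomial.aeval_monomial]
    exact (SemiconjBy.mul_right (Algebra.commutes c S).symm (h.pow_right n))

theorem sqrt_eq_cfc_real {D : Op H} (hD : 0 ≤ D) : CFC.sqrt D = cfc Real.sqrt D := by
  rw [CFC.sqrt_eq_real_sqrt D hD, cfcₙ_eq_cfc]

theorem isSelfAdjoint_sqrt (D : Op H) : IsSelfAdjoint (CFC.sqrt D) :=
  IsSelfAdjoint.of_nonneg (CFC.sqrt_nonneg D)

theorem isSelfAdjoint_invSqrt (D : Op H) : IsSelfAdjoint (invSqrt D) := cfc_predicate _ _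

/-- The support projection of a positive operator. -/
def supportProj (D : Op H) : Op H := cfc (fun x : ℝ => Real.sqrt x * (Real.sqrt x)⁻¹) D

theorem sqrt_mul_invSqrt {D : Op H} (hD : 0 ≤ D) : CFC.sqrt D * invSqrt D = supportProj D := by
  rw [sqrt_eq_cfc_real hD, invSqrt, supportProj, cfc_mul _ _ D (continuousOn_real_spectrum _ D)
    (continuousOn_real_spectrum _ D)]

theorem invSqrt_mul_sqrt {D : Op H} (hD : 0 ≤ D) : invSqrt D * CFC.sqrt D = supportProj D := by
  rw [← sqrt_mul_invSqrt hD, sqrt_eq_cfc_real hD, invSqrt]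
  exact cfc_commute_cfc _ _ _

theorem isSelfAdjoint_supportProj (D : Op H) : IsSelfAdjoint (supportProj D) := cfc_predicate _ _

theorem supportProj_mul_self {D : Op H} (hD : 0 ≤ D) : supportProj D * D = D := by
  have h : supportProj D * cfc (id : ℝ → ℝ) D = cfc (id : ℝ → ℝ) D := by
    rw [supportProj, ← cfc_mul _ _ D (continuousOn_real_spectrum _ D)
      (continuousOn_real_spectrum _ D)]
    refine cfc_congr fun x hx => ?_
    have hx0 : 0 ≤ x := spectrum_nonneg_of_nonneg hD hx
    rcases hx0.eq_or_lt with rfl | h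
    · simp
    · have := (Real.sqrt_pos.2 h).ne'
      simp [this]
  rwa [cfc_id ℝ D (IsSelfAdjoint.of_nonneg hD)] at h

theorem supportProj_le_one (D : Op H) : supportProj D ≤ 1 := by
  refine cfc_le_one _ _ fun x _ => ?_
  by_cases h : Real.sqrt x = 0
  · simp [h]
  · simp [h]

/-- With `Q` the projection onto `ker D`, `0 ≤ QRQ ≤ QDQ = 0`. Hence `R^{1/2} Q = 0`, and so `RQ =
0`. -/
theorem mul_supportProj_of_le {R D : Op H} (hR : 0 ≤ R) (hRD : R ≤ D) : R * supportProj D = R := by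
  have hD := hR.trans hRD
  set Q := 1 - supportProj D with hQ
  have hQs : star Q = Q := by simp [hQ, (isSelfAdjoint_supportProj D).star_eq]
  have h1 : star Q * R * Q ≤ star Q * D * Q := star_left_conjugate_le_conjugate hRD Q
  have h2 : star Q * D * Q = 0 := by
    rw [hQs, hQ, sub_mul (1 : Op H), one_mul, supportProj_mul_self hD, sub_self, zero_mul]
  have h3 : star Q * R * Q = 0 :=
    le_antisymm (h2 ▸ h1) (star_left_conjugate_nonneg hR Q)
  have h4 : star (CFC.sqrt R * Q) * (CFC.sqrt R * Q) = 0 := by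
    rw [star_mul, (isSelfAdjoint_sqrt R).star_eq, mul_assoc, ← mul_assoc (CFC.sqrt R),
      CFC.sqrt_mul_sqrt_self R hR, ← mul_assoc, h3]
  have h5 : CFC.sqrt R * Q = 0 := CStarRing.star_mul_self_eq_zero_iff _ |>.1 h4
  have h6 : R * Q = 0 := by
    rw [← CFC.sqrt_mul_sqrt_self R hR, mul_assoc, h5, mul_zero]
  rw [hQ, mul_sub, mul_one, sub_eq_zero] at h6
  exact h6.symm

theorem supportProj_mul_of_le {R D : Op H} (hR : 0 ≤ R) (hRD : R ≤ D) : supportProj D * R = R := by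
  have h := congrArg star (mul_supportProj_of_le hR hRD)
  rwa [star_mul, (isSelfAdjoint_supportProj D).star_eq, (IsSelfAdjoint.of_nonneg hR).star_eq] at h

/-- The quotient `(D⁺)^{1/2} R (D⁺)^{1/2}` recovers `R` when sandwiched by `D^{1/2}`. -/
theorem sqrt_conj_invSqrt_conj {R D : Op H} (hR : 0 ≤ R) (hRD : R ≤ D) :
    CFC.sqrt D * (invSqrt D * R * invSqrt D) * CFC.sqrt D = R := by
  have hD := hR.trans hRD
  calc _ = (CFC.sqrt D * invSqrt D) * R * (invSqrt D * CFC.sqrt D) := by noncomm_ring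
    _ = R := by
      rw [sqrt_mul_invSqrt hD, invSqrt_mul_sqrt hD, supportProj_mul_of_le hR hRD,
        mul_supportProj_of_le hR hRD]

theorem invSqrt_conj_nonneg {R : Op H} (D : Op H) (hR : 0 ≤ R) :
    0 ≤ invSqrt D * R * invSqrt D := by
  have := star_left_conjugate_nonneg hR (invSqrt D)
  rwa [(isSelfAdjoint_invSqrt D).star_eq] at this

/-- Conjugating `R ≤ D` bounds the quotient by the support projection of `D`. -/
theorem invSqrt_conj_le_one {R D : Op H} (hR : 0 ≤ R) (hRD : R ≤ D) :
    invSqrt D * R * invSqrt D ≤ 1 := by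
  have hD := hR.trans hRD
  have h1 := (isSelfAdjoint_invSqrt D).conjugate_le_conjugate hRD
  have h2 : invSqrt D * D * invSqrt D = supportProj D * supportProj D := by
    calc _ = invSqrt D * (CFC.sqrt D * CFC.sqrt D) * invSqrt D := by
          rw [CFC.sqrt_mul_sqrt_self D hD]
      _ = (invSqrt D * CFC.sqrt D) * (CFC.sqrt D * invSqrt D) := by noncomm_ring
      _ = _ := by rw [invSqrt_mul_sqrt hD, sqrt_mul_invSqrt hD]
  have h3 : supportProj D * supportProj D = supportProj D := by
    rw [supportProj, ← cfc_mul _ _ D (continuousOn_real_spectrum _ D)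
      (continuousOn_real_spectrum _ D)]
    refine cfc_congr fun x _ => ?_
    by_cases h : Real.sqrt x = 0 <;> simp [h]
  rw [h2, h3] at h1
  exact h1.trans (supportProj_le_one D)

/-- On a finite spectrum pointwise convergence is already uniform. -/
theorem tendsto_cfc_of_pointwise {ι : Type*} {l : Filter ι} {F : ι → ℝ → ℝ} {f : ℝ → ℝ} (a : Op H)
    (h : ∀ x ∈ spectrum ℝ a, Tendsto (fun i => F i x) l (𝓝 (f x))) :
    Tendsto (fun i => cfc (F i) a) l (𝓝 (cfc f a)) := by
  refine tendsto_cfc_fun ?_ (Eventually.of_forall fun i => continuousOn_real_spectrum _ a)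
  rw [Metric.tendstoUniformlyOn_iff]
  intro ε hε
  refine (eventually_all_finite (finite_real_spectrum a)).2 fun x hx => ?_
  filter_upwards [Metric.tendsto_nhds.1 (h x hx) ε hε] with i hi
  rwa [dist_comm]

/-- Regularizing the inverse square roots gives the Moore–Penrose quotient in the limit. -/
theorem tendsto_invSqrt_conj {R D : Op H} (hR : 0 ≤ R) (hRD : R ≤ D) :
    Tendsto (fun ε : ℝ => invSqrt (D + (ε : ℂ) • 1) * R * invSqrt (D + (ε : ℂ) • 1)) (𝓝[>] 0)
      (𝓝 (invSqrt D * R * invSqrt D)) := by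
  have hD := hR.trans hRD
  have hDs := IsSelfAdjoint.of_nonneg hD
  have h1 : ∀ ε : ℝ, invSqrt (D + (ε : ℂ) • 1) = cfc (fun x : ℝ => (Real.sqrt (x + ε))⁻¹) D := by
    intro ε
    have h2 : D + (ε : ℂ) • 1 = cfc (fun x : ℝ => x + ε) D := by
      rw [cfc_add_const ε (fun x => x) D (continuousOn_real_spectrum _ D) hDs, cfc_id' ℝ D hDs,
        Algebra.algebraMap_eq_smul_one]
      congr 1
    rw [h2, invSqrt, ← cfc_comp' (fun x : ℝ => (Real.sqrt x)⁻¹) (fun x : ℝ => x + ε) D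
      (((finite_real_spectrum D).image _).continuousOn _) (continuousOn_real_spectrum _ D) hDs]
  -- At the eigenvalue `0` the function `(x + ε)^{-1/2}` diverges; the support projection removes
  -- that eigenvalue. It may be inserted because `R` absorbs it on both sides.
  have hlim : Tendsto (fun ε : ℝ => cfc (fun x : ℝ => (Real.sqrt (x + ε))⁻¹) D * supportProj D)
      (𝓝[>] 0) (𝓝 (invSqrt D)) := by
    simp only [supportProj, invSqrt]
    simp only [← cfc_mul _ _ D (continuousOn_real_spectrum _ D) (continuousOn_real_spectrum _ D)]
    refine tendsto_cfc_of_pointwise D fun x hx => ?_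
    have hx0 : 0 ≤ x := spectrum_nonneg_of_nonneg hD hx
    rcases hx0.eq_or_lt with rfl | h
    · simp
    · have hs := (Real.sqrt_pos.2 h).ne'
      have hc : Tendsto (fun ε : ℝ => (Real.sqrt (x + ε))⁻¹) (𝓝[>] 0) (𝓝 (Real.sqrt x)⁻¹) := by
        have : ContinuousAt (fun ε : ℝ => (Real.sqrt (x + ε))⁻¹) 0 := by
          refine ContinuousAt.inv₀ (by fun_prop) ?_
          simpa using hs
        have h2 := this.tendsto
        rw [add_zero] at h2
        exact h2.mono_left nhdsWithin_le_nhds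
      simpa [hs] using hc
  have hcomm : ∀ ε : ℝ, supportProj D * cfc (fun x : ℝ => (Real.sqrt (x + ε))⁻¹) D
      = cfc (fun x : ℝ => (Real.sqrt (x + ε))⁻¹) D * supportProj D := fun ε =>
    cfc_commute_cfc _ _ _
  have h3 : ∀ ε : ℝ, invSqrt (D + (ε : ℂ) • 1) * R * invSqrt (D + (ε : ℂ) • 1)
      = (cfc (fun x : ℝ => (Real.sqrt (x + ε))⁻¹) D * supportProj D) * R *
        (cfc (fun x : ℝ => (Real.sqrt (x + ε))⁻¹) D * supportProj D) := by
    intro ε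
    have h4 : R = supportProj D * R * supportProj D := by
      rw [supportProj_mul_of_le hR hRD, mul_supportProj_of_le hR hRD]
    rw [h1]
    set f := cfc (fun x : ℝ => (Real.sqrt (x + ε))⁻¹) D with hf
    calc f * R * f = f * (supportProj D * R * supportProj D) * f := by rw [← h4]
      _ = (f * supportProj D) * R * (supportProj D * f) := by noncomm_ring
      _ = _ := by rw [hcomm]
  simp only [h3]
  exact (hlim.mul_const R).mul hlim

theorem norm_sqrt_mul_self {D : Op H} (hD : 0 ≤ D) : ‖CFC.sqrt D‖ * ‖CFC.sqrt D‖ = ‖D‖ := by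
  rw [← CStarRing.norm_star_mul_self, (isSelfAdjoint_sqrt D).star_eq, CFC.sqrt_mul_sqrt_self D hD]

theorem one_sub_star_mul_self_nonneg {S : Op H} (hS : 0 ≤ 1 - S * star S) :
    0 ≤ 1 - star S * S := by
  have h1 : ‖S * star S‖ ≤ 1 :=
    (CStarAlgebra.norm_le_one_iff_of_nonneg _ (mul_star_self_nonneg S)).2 (sub_nonneg.1 hS)
  rw [CStarRing.norm_self_mul_star, ← CStarRing.norm_star_mul_self] at h1
  exact sub_nonneg.2 ((CStarAlgebra.norm_le_one_iff_of_nonneg _ (star_mul_self_nonneg S)).1 h1)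

/-- `S` intertwines `1 - S*S` with `1 - SS*`, hence also their square roots. This cancels the
off-diagonal blocks of the squared dilation. -/
theorem mul_sqrt_one_sub {S : Op H} (hS : 0 ≤ 1 - S * star S) :
    S * CFC.sqrt (1 - star S * S) = CFC.sqrt (1 - S * star S) * S := by
  have hS' := one_sub_star_mul_self_nonneg hS
  rw [sqrt_eq_cfc_real hS, sqrt_eq_cfc_real hS']
  refine semiconjBy_cfc (IsSelfAdjoint.of_nonneg hS') (IsSelfAdjoint.of_nonneg hS) ?_ _
  simp only [SemiconjBy]
  noncomm_ring

theorem dilation_apply (S : Op H) (ξ : WithLp 2 (H × H)) :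
    dilation S ξ = WithLp.toLp 2 (-CFC.sqrt (1 - S * star S) ξ.fst + S ξ.snd,
      star S ξ.fst + CFC.sqrt (1 - star S * S) ξ.snd) := rfl

theorem star_dilation (S : Op H) : star (dilation S) = dilation S := by
  have h : ∀ (B : Op H) (x y : H), ⟪star B x, y⟫_ℂ = ⟪x, B y⟫_ℂ := fun B x y => by
    rw [ContinuousLinearMap.star_eq_adjoint, ContinuousLinearMap.adjoint_inner_left]
  have h' : ∀ (B : Op H), IsSelfAdjoint B → ∀ x y : H, ⟪B x, y⟫_ℂ = ⟪x, B y⟫_ℂ := fun B hB x y => by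
    rw [← h, hB.star_eq]
  have h'' : ∀ (B : Op H) (x y : H), ⟪B x, y⟫_ℂ = ⟪x, star B y⟫_ℂ := fun B x y => by
    rw [← h, star_star]
  refine ContinuousLinearMap.ext fun ξ => ext_inner_right ℂ fun ζ => ?_
  rw [ContinuousLinearMap.star_eq_adjoint, ContinuousLinearMap.adjoint_inner_left, dilation_apply,
    dilation_apply, WithLp.prod_inner_apply, WithLp.prod_inner_apply]
  simp only [inner_add_left, inner_add_right, inner_neg_left, inner_neg_right, h,
    h' _ (isSelfAdjoint_sqrt _), h'' S]
  simp only [WithLp.fst, WithLp.snd]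
  ring

theorem dilation_mul_self {S : Op H} (hS : 0 ≤ 1 - S * star S) :
    dilation S * dilation S = 1 := by
  have hS' := one_sub_star_mul_self_nonneg hS
  have h1 := mul_sqrt_one_sub hS
  have h2 : CFC.sqrt (1 - star S * S) * star S = star S * CFC.sqrt (1 - S * star S) := by
    have := congrArg star h1
    simpa only [star_mul, (isSelfAdjoint_sqrt _).star_eq] using this
  have h3 := CFC.sqrt_mul_sqrt_self _ hS
  have h4 := CFC.sqrt_mul_sqrt_self _ hS'
  set Q := CFC.sqrt (1 - S * star S) with hQ
  set Q' := CFC.sqrt (1 - star S * S) with hQ'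
  have ev : ∀ {A B : Op H}, A = B → ∀ x, A x = B x := fun h x => by rw [h]
  have e1 : ∀ x, S (Q' x) = Q (S x) := ev h1
  have e2 : ∀ x, Q' (star S x) = star S (Q x) := ev h2
  have e3 : ∀ x, Q (Q x) = x - S (star S x) := ev h3
  have e4 : ∀ x, Q' (Q' x) = x - star S (S x) := ev h4
  refine ContinuousLinearMap.ext fun ξ => ?_
  rw [mul_apply_eq_comp, dilation_apply, dilation_apply, one_apply_eq_self, ← hQ, ← hQ']
  apply WithLp.ofLp_injective
  refine Prod.ext ?_ ?_
  · simp only [map_add, map_neg, e1, e3, WithLp.toLp_fst, WithLp.toLp_snd]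
    simp only [WithLp.fst]
    abel
  · simp only [map_add, map_neg, e2, e4, WithLp.toLp_fst, WithLp.toLp_snd]
    simp only [WithLp.snd]
    abel

end FunctionalCalculus
-- The contraction semigroup and its covariance integral
section Semigroup

theorem star_exp_smul (G : Op H) (t : ℝ) :
    star (NormedSpace.exp ((t : ℂ) • G)) = NormedSpace.exp ((t : ℂ) • star G) := by
  rw [NormedSpace.star_exp, star_smul]
  simp

theorem hasDerivAt_exp_smul (G : Op H) (t : ℝ) :
    HasDerivAt (fun s : ℝ => NormedSpace.exp ((s : ℂ) • G))
      (NormedSpace.exp ((t : ℂ) • G) * G) t := by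
  simpa only [Complex.coe_smul] using hasDerivAt_exp_smul_const (𝕂 := ℝ) G t

theorem hasDerivAt_exp_smul' (G : Op H) (t : ℝ) :
    HasDerivAt (fun s : ℝ => NormedSpace.exp ((s : ℂ) • G))
      (G * NormedSpace.exp ((t : ℂ) • G)) t := by
  simpa only [Complex.coe_smul] using hasDerivAt_exp_smul_const' (𝕂 := ℝ) G t

theorem continuous_exp_smul (G : Op H) :
    Continuous fun s : ℝ => NormedSpace.exp ((s : ℂ) • G) :=
  continuous_iff_continuousAt.2 fun t => (hasDerivAt_exp_smul G t).continuousAt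

theorem continuous_exp_conj (G M : Op H) : Continuous fun s : ℝ =>
    NormedSpace.exp ((s : ℂ) • G) * M * NormedSpace.exp ((s : ℂ) • star G) :=
  ((continuous_exp_smul G).mul continuous_const).mul (continuous_exp_smul (star G))

theorem covarianceIntegral_sub (G M M' : Op H) (t : ℝ) :
    covarianceIntegral G (M - M') t = covarianceIntegral G M t - covarianceIntegral G M' t := by
  rw [covarianceIntegral, covarianceIntegral, covarianceIntegral,
    ← intervalIntegral.integral_sub ((continuous_exp_conj G M).intervalIntegrable _ _)
      ((continuous_exp_conj G M').intervalIntegrable _ _)]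
  simp only [mul_sub, sub_mul]

theorem covarianceIntegral_nonneg (G : Op H) {M : Op H} (hM : 0 ≤ M) {t : ℝ} (ht : 0 ≤ t) :
    0 ≤ covarianceIntegral G M t := by
  rw [covarianceIntegral, intervalIntegral.integral_of_le ht]
  refine MeasureTheory.integral_nonneg fun s => ?_
  have := star_right_conjugate_nonneg hM (NormedSpace.exp ((s : ℂ) • G))
  rwa [star_exp_smul] at this

/-- The defect of the contraction `e^{tG}`. -/
theorem one_sub_exp_mul_star (G : Op H) (t : ℝ) :
    1 - NormedSpace.exp ((t : ℂ) • G) * star (NormedSpace.exp ((t : ℂ) • G))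
      = covarianceIntegral G (-G - star G) t := by
  -- The integrand is the derivative of `-e^{sG} e^{sG*}`, because `G` and `G*` commute with their
  -- own exponentials.
  have h := intervalIntegral.integral_eq_sub_of_hasDerivAt (a := 0) (b := t)
    (f := fun s : ℝ => -(NormedSpace.exp ((s : ℂ) • G) * NormedSpace.exp ((s : ℂ) • star G)))
    (f' := fun s : ℝ => NormedSpace.exp ((s : ℂ) • G) * (-G - star G) *
      NormedSpace.exp ((s : ℂ) • star G))
    (fun s _ => by
      convert! ((hasDerivAt_exp_smul G s).mul (hasDerivAt_exp_smul' (star G) s)).neg using 1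
      noncomm_ring)
    ((continuous_exp_conj G _).intervalIntegrable _ _)
  rw [covarianceIntegral, h, star_exp_smul]
  simp
  abel

theorem tendsto_inv_smul_covarianceIntegral (G M : Op H) :
    Tendsto (fun t : ℝ => (t : ℂ)⁻¹ • covarianceIntegral G M t) (𝓝[>] 0) (𝓝 M) := by
  have h := ((continuous_exp_conj G M).integral_hasStrictDerivAt 0 0).hasDerivAt
  have h2 := h.tendsto_slope_zero_right
  simp only [intervalIntegral.integral_same, sub_zero, zero_add, Complex.ofReal_zero, zero_smul,
    NormedSpace.exp_zero, one_mul, mul_one] at h2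
  refine h2.congr fun t => ?_
  rw [← Complex.ofReal_inv, Complex.coe_smul]
  rfl

theorem tendsto_inv_smul_exp_sub_one (G : Op H) :
    Tendsto (fun t : ℝ => (t : ℂ)⁻¹ • (NormedSpace.exp ((t : ℂ) • G) - 1)) (𝓝[>] 0) (𝓝 G) := by
  have h2 := (hasDerivAt_exp_smul G 0).tendsto_slope_zero_right
  simp only [zero_add, Complex.ofReal_zero, zero_smul, NormedSpace.exp_zero, one_mul] at h2
  refine h2.congr fun t => ?_
  rw [← Complex.ofReal_inv, Complex.coe_smul t⁻¹]

end Semigroup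

/-! ### Irreducibility and the generated algebra -/

section Burnside

variable {Z : H →ₗ⋆[ℂ] Op K}

/-- Burnside's theorem: an irreducible family of operators generates the full operator algebra. -/
theorem ActsIrreducibly.adjoin_eq_top (h : ActsIrreducibly Z) :
    Algebra.adjoin ℂ ({X | ∃ ψ, X = Z ψ ∨ X = star (Z ψ)} : Set (Op K)) = ⊤ := by
  classical
  set s : Set (Op K) := {X | ∃ ψ, X = Z ψ ∨ X = star (Z ψ)} with hs
  set A := Algebra.adjoin ℂ s with hA
  have := h.1
  have hsmul : ∀ (a : A) (v : K), a • v = (a : Op K) v := fun _ _ => rfl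
  have : IsScalarTower ℂ A K := ⟨fun c a v => rfl⟩
  have : SMulCommClass ℂ A K := ⟨fun c a v => by simp [hsmul]⟩
  have : IsSimpleModule A K := by
    rw [isSimpleModule_iff]
    refine { exists_pair_ne := ⟨⊥, ⊤, bot_ne_top⟩, eq_bot_or_eq_top := fun M => ?_ }
    have h2 := h.2 (M.restrictScalars ℂ) fun ψ v hv =>
      ⟨M.smul_mem ⟨Z ψ, Algebra.subset_adjoin ⟨ψ, Or.inl rfl⟩⟩ hv,
        M.smul_mem ⟨star (Z ψ), Algebra.subset_adjoin ⟨ψ, Or.inr rfl⟩⟩ hv⟩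
    simpa using h2
  have hschur := (IsSimpleModule.algebraMap_end_bijective_of_isAlgClosed ℂ (A := A) (V := K)).2
  rw [eq_top_iff]
  intro X _
  -- By Schur's lemma the commutant consists of scalars, so every operator is linear over it;
  -- Jacobson density then finds an element of `A` that agrees with `X` on a basis.
  let f : Module.End (Module.End A K) K :=
    { toFun := X
      map_add' := map_add X
      map_smul' := fun g v => by
        obtain ⟨c, rfl⟩ := hschur g
        simp }
  obtain ⟨r, hr⟩ := jacobson_density (R := A) f
    (Finset.univ.image (stdOrthonormalBasis ℂ K))
  have : X = (r : Op K) := by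
    refine ContinuousLinearMap.coe_injective ((stdOrthonormalBasis ℂ K).toBasis.ext fun k => ?_)
    have := hr (stdOrthonormalBasis ℂ K k) (Finset.mem_image_of_mem _ (Finset.mem_univ k))
    exact this
  rw [this]
  exact r.2

end Burnside
-- Graded commutators and twisted dissipators
section GradedCommutators

variable {Z : H →ₗ⋆[ℂ] Op K}

/-- The principal automorphism `X ↦ W X W`. -/
def parityConj (Z : H → Op K) (X : Op K) : Op K := parityOp Z * X * parityOp Z

/-- The graded commutator of an odd operator `B` with `X`. -/
def gradedComm (Z : H → Op K) (B X : Op K) : Op K := B * X - parityConj Z X * B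

theorem IsCARField.parityConj_mul (hZ : IsCARField Z) (X Y : Op K) :
    parityConj Z (X * Y) = parityConj Z X * parityConj Z Y := hZ.parity_conj_mul X Y

theorem IsCARField.parityConj_parityConj (hZ : IsCARField Z) (X : Op K) :
    parityConj Z (parityConj Z X) = X := by
  calc parityConj Z (parityConj Z X) = (parityOp Z * parityOp Z) * X * (parityOp Z * parityOp Z) := by
        simp only [parityConj]; noncomm_ring
    _ = X := by rw [hZ.parityOp_mul_self, one_mul, mul_one]

theorem IsCARField.star_parityConj (hZ : IsCARField Z) (X : Op K) :
    star (parityConj Z X) = parityConj Z (star X) := by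
  simp only [parityConj, star_mul, hZ.star_parityOp, mul_assoc]

theorem parityConj_add (Z : H → Op K) (X Y : Op K) :
    parityConj Z (X + Y) = parityConj Z X + parityConj Z Y := by
  simp only [parityConj, mul_add, add_mul]

theorem parityConj_sub (Z : H → Op K) (X Y : Op K) :
    parityConj Z (X - Y) = parityConj Z X - parityConj Z Y := by
  simp only [parityConj, mul_sub, sub_mul]

theorem parityConj_smul (Z : H → Op K) (c : ℂ) (X : Op K) :
    parityConj Z (c • X) = c • parityConj Z X := by
  simp only [parityConj, mul_smul_comm, smul_mul_assoc]

theorem IsCARField.parityConj_one (hZ : IsCARField Z) : parityConj Z 1 = 1 := by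
  rw [parityConj, mul_one, hZ.parityOp_mul_self]

theorem IsCARField.gradedComm_one (hZ : IsCARField Z) (B : Op K) : gradedComm Z B 1 = 0 := by
  rw [gradedComm, hZ.parityConj_one, mul_one, one_mul, sub_self]

theorem gradedComm_add (Z : H → Op K) (B X Y : Op K) :
    gradedComm Z B (X + Y) = gradedComm Z B X + gradedComm Z B Y := by
  simp only [gradedComm, parityConj_add, mul_add, add_mul]
  abel

theorem gradedComm_smul (Z : H → Op K) (c : ℂ) (B X : Op K) :
    gradedComm Z B (c • X) = c • gradedComm Z B X := by
  simp only [gradedComm, parityConj_smul, mul_smul_comm, smul_mul_assoc, smul_sub]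

/-- The graded Leibniz rule; it is the algebraic source of both `linearNoise_mul` and the carré du
champ. -/
theorem IsCARField.gradedComm_mul (hZ : IsCARField Z) (B X Y : Op K) :
    gradedComm Z B (X * Y) = gradedComm Z B X * Y + parityConj Z X * gradedComm Z B Y := by
  simp only [gradedComm, hZ.parityConj_mul]
  noncomm_ring

theorem IsCARField.parityConj_gradedComm (hZ : IsCARField Z) {B : Op K}
    (hB : parityConj Z B = -B) (X : Op K) :
    parityConj Z (gradedComm Z B X) = X * B - B * parityConj Z X := by
  rw [gradedComm, parityConj_sub, hZ.parityConj_mul, hZ.parityConj_mul, hZ.parityConj_parityConj, hB]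
  noncomm_ring

/-- The generator of Lindblad form, twisted by the parity, with a single noise operator `B`. -/
def dissipator (Z : H → Op K) (B X : Op K) : Op K :=
  star B * parityConj Z X * B - (1 / 2 : ℂ) • (star B * B * X) - (1 / 2 : ℂ) • (X * (star B * B))

/-- The carré du champ identity of a dissipator. -/
theorem IsCARField.dissipator_mul (hZ : IsCARField Z) {B : Op K} (hB : parityConj Z B = -B)
    (X Y : Op K) : dissipator Z B (X * Y) = dissipator Z B X * Y + X * dissipator Z B Y
      + parityConj Z (gradedComm Z (star B) X) * gradedComm Z B Y := by
  have hB' : parityConj Z (star B) = -star B := by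
    rw [← hZ.star_parityConj, hB, star_neg]
  rw [hZ.parityConj_gradedComm hB']
  simp only [dissipator, gradedComm, hZ.parityConj_mul, mul_sub, sub_mul, smul_mul_assoc,
    mul_smul_comm, mul_assoc]
  module

theorem dissipator_add (Z : H → Op K) (B X Y : Op K) :
    dissipator Z B (X + Y) = dissipator Z B X + dissipator Z B Y := by
  simp only [dissipator, parityConj_add, mul_add, add_mul, smul_add]
  abel

theorem dissipator_smul (Z : H → Op K) (B : Op K) (c : ℂ) (X : Op K) :
    dissipator Z B (c • X) = c • dissipator Z B X := by
  simp only [dissipator, parityConj_smul, mul_smul_comm, smul_mul_assoc, smul_sub]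
  simp only [smul_smul, mul_comm c]

theorem IsCARField.dissipator_one (hZ : IsCARField Z) (B : Op K) : dissipator Z B 1 = 0 := by
  simp only [dissipator, hZ.parityConj_one, mul_one, one_mul]
  module

theorem IsCARField.star_dissipator (hZ : IsCARField Z) (B X : Op K) :
    star (dissipator Z B X) = dissipator Z B (star X) := by
  simp only [dissipator, star_sub, star_smul, star_mul, star_star, hZ.star_parityConj, mul_assoc]
  simp only [star_div₀, star_one, star_ofNat]
  abel

/-- By the CAR the sandwich term equals `Z*(φ)Z(φ)Z(ψ)`, so only half the commutator of `Z*(φ)Z(φ)`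
with `Z(ψ)` is left. -/
theorem IsCARField.dissipator_field (hZ : IsCARField Z) (φ ψ : H) :
    dissipator Z (Z φ) (Z ψ) = -((1 / 2 : ℂ) • ⟪ψ, φ⟫_ℂ • Z φ) := by
  have h := hZ.star_mul_mul_sub φ φ ψ
  have h1 : star (Z φ) * -Z ψ * Z φ = star (Z φ) * Z φ * Z ψ := by
    rw [mul_neg, neg_mul, mul_assoc, hZ.mul_eq_neg ψ φ, mul_neg, neg_neg, mul_assoc]
  rw [dissipator, show parityConj Z (Z ψ) = -Z ψ from hZ.parity_conj_field ψ, h1, ← smul_neg, ← h]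
  module

/-- The value agrees with that of `dissipator_field`, which is why the occupation numbers drop out
of the generator on fields. -/
theorem IsCARField.dissipator_star_field (hZ : IsCARField Z) (φ ψ : H) :
    dissipator Z (star (Z φ)) (Z ψ) = -((1 / 2 : ℂ) • ⟪ψ, φ⟫_ℂ • Z φ) := by
  have h := hZ.star_mul_mul_sub φ φ ψ
  have h0 : Z φ * star (Z φ) = ⟪φ, φ⟫_ℂ • (1 : Op K) - star (Z φ) * Z φ :=
    eq_sub_of_add_eq (hZ.anticomm_star φ φ)
  have h1 : Z φ * -Z ψ * star (Z φ) = Z ψ * (Z φ * star (Z φ)) := by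
    rw [mul_neg, neg_mul, hZ.mul_eq_neg φ ψ, neg_mul, neg_neg, mul_assoc]
  rw [dissipator, star_star, show parityConj Z (Z ψ) = -Z ψ from hZ.parity_conj_field ψ, h1, h0,
    ← smul_neg, ← h]
  simp only [mul_sub, sub_mul, mul_smul_comm, smul_mul_assoc, mul_one, one_mul]
  module

theorem IsCARField.gradedComm_star_field_field (hZ : IsCARField Z) (φ ψ : H) :
    gradedComm Z (star (Z φ)) (Z ψ) = ⟪ψ, φ⟫_ℂ • (1 : Op K) := by
  rw [gradedComm, show parityConj Z (Z ψ) = -Z ψ from hZ.parity_conj_field ψ, ← hZ.anticomm_star]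
  noncomm_ring

theorem IsCARField.gradedComm_field_field (hZ : IsCARField Z) (φ ψ : H) :
    gradedComm Z (Z φ) (Z ψ) = 0 := by
  rw [gradedComm, show parityConj Z (Z ψ) = -Z ψ from hZ.parity_conj_field ψ, ← hZ.anticomm φ ψ]
  noncomm_ring

theorem IsCARField.gradedComm_star_field_star_field (hZ : IsCARField Z) (φ ψ : H) :
    gradedComm Z (star (Z φ)) (star (Z ψ)) = 0 := by
  rw [gradedComm, show parityConj Z (star (Z ψ)) = -star (Z ψ) from hZ.parity_conj_star_field ψ,
    ← hZ.star_anticomm φ ψ]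
  noncomm_ring

theorem IsCARField.gradedComm_field_star_field (hZ : IsCARField Z) (φ ψ : H) :
    gradedComm Z (Z φ) (star (Z ψ)) = ⟪φ, ψ⟫_ℂ • (1 : Op K) := by
  rw [gradedComm, show parityConj Z (star (Z ψ)) = -star (Z ψ) from hZ.parity_conj_star_field ψ,
    ← hZ.anticomm_star]
  noncomm_ring

end GradedCommutators

/-! ### The noise fields and the derivation they define -/

section Noise

variable {Z : H →ₗ⋆[ℂ] Op K}

/-- The noise field `ψ ↦ Z(-Qψ ⊕ 0)`. -/
def noiseField (Z : H →ₗ⋆[ℂ] Op K) (Q : Op H) : H →ₗ⋆[ℂ] Op (K ⊗[ℂ] K) where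
  toFun ψ := tensorOp (Z (-Q ψ)) (parityOp Z)
  map_add' ψ φ := by rw [map_add, neg_add, map_add, tensorOp_add_left]
  map_smul' c ψ := by rw [map_smul, ← smul_neg, LinearMap.map_smulₛₗ, tensorOp_smul_left]

theorem noiseField_apply (Z : H →ₗ⋆[ℂ] Op K) (Q : Op H) (ψ : H) :
    noiseField Z Q ψ = tensorOp (Z (-Q ψ)) (parityOp Z) := rfl

theorem IsCARField.star_noiseField (hZ : IsCARField Z) (Q : Op H) (ψ : H) :
    star (noiseField Z Q ψ) = tensorOp (star (Z (-Q ψ))) (parityOp Z) := by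
  rw [noiseField_apply, star_tensorOp, hZ.star_parityOp]

/-- The noise carries `W` in the right factor, and `XW = W(WXW)`. This twist produces the parity
conjugation in the generator. -/
theorem IsCARField.embedRight_mul_noiseField (hZ : IsCARField Z) (Q : Op H) (ψ : H) (X : Op K) :
    embedRight X * noiseField Z Q ψ = noiseField Z Q ψ * embedRight (parityConj Z X) := by
  rw [noiseField_apply, embedRight_apply, embedRight_apply, ← tensorOp_mul, ← tensorOp_mul, one_mul,
    mul_one, parityConj, mul_assoc (parityOp _), ← mul_assoc, hZ.parityOp_mul_self, one_mul]

theorem IsCARField.embedRight_mul_star_noiseField (hZ : IsCARField Z) (Q : Op H) (ψ : H)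
    (X : Op K) : embedRight X * star (noiseField Z Q ψ)
      = star (noiseField Z Q ψ) * embedRight (parityConj Z X) := by
  rw [hZ.star_noiseField, embedRight_apply, embedRight_apply, ← tensorOp_mul, ← tensorOp_mul,
    one_mul, mul_one, parityConj, mul_assoc (parityOp _), ← mul_assoc, hZ.parityOp_mul_self, one_mul]

/-- The part of the dilated operator which is linear in the noise. -/
def linearNoise {ι : Type*} [Fintype ι] (Z : H →ₗ⋆[ℂ] Op K) (e : OrthonormalBasis ι ℂ H) (Q : Op H)
    (X : Op K) : Op (K ⊗[ℂ] K) :=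
  ∑ j, (noiseField Z Q (e j) * embedRight (gradedComm Z (star (Z (e j))) X)
    + star (noiseField Z Q (e j)) * embedRight (gradedComm Z (Z (e j)) X))

variable {ι : Type*} [Fintype ι] (e : OrthonormalBasis ι ℂ H)

theorem linearNoise_add (Z : H →ₗ⋆[ℂ] Op K) (Q : Op H) (X Y : Op K) :
    linearNoise Z e Q (X + Y) = linearNoise Z e Q X + linearNoise Z e Q Y := by
  rw [linearNoise, linearNoise, linearNoise, ← Finset.sum_add_distrib]
  refine Finset.sum_congr rfl fun j _ => ?_
  rw [gradedComm_add, gradedComm_add, map_add, map_add, mul_add, mul_add]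
  abel

theorem IsCARField.linearNoise_smul_one (hZ : IsCARField Z) (Q : Op H) (c : ℂ) :
    linearNoise Z e Q (c • 1) = 0 := by
  simp only [linearNoise, gradedComm_smul, hZ.gradedComm_one, smul_zero, map_zero, mul_zero,
    add_zero, Finset.sum_const_zero]

/-- In the graded Leibniz rule the parity conjugation of `X` is undone by moving `X` to the left of
the noise, leaving an ordinary derivation. -/
theorem IsCARField.linearNoise_mul (hZ : IsCARField Z) (Q : Op H) (X Y : Op K) :
    linearNoise Z e Q (X * Y)
      = linearNoise Z e Q X * embedRight Y + embedRight X * linearNoise Z e Q Y := by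
  rw [linearNoise, linearNoise, linearNoise, Finset.sum_mul, Finset.mul_sum,
    ← Finset.sum_add_distrib]
  refine Finset.sum_congr rfl fun j _ => ?_
  rw [mul_add (embedRight X), ← mul_assoc, hZ.embedRight_mul_noiseField, ← mul_assoc,
    hZ.embedRight_mul_star_noiseField, hZ.gradedComm_mul, hZ.gradedComm_mul, map_add, map_add]
  simp only [embedRight_mul, mul_add, add_mul, mul_assoc]
  abel

theorem IsCARField.linearNoise_field (hZ : IsCARField Z) (Q : Op H) (ψ : H) :
    linearNoise Z e Q (Z ψ) = noiseField Z Q ψ := by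
  rw [linearNoise, map_eq_sum_inner e (noiseField Z Q) ψ]
  refine Finset.sum_congr rfl fun j _ => ?_
  rw [hZ.gradedComm_star_field_field, hZ.gradedComm_field_field, map_smul, map_zero, mul_zero,
    add_zero, embedRight_one, mul_smul_comm, mul_one]

theorem IsCARField.linearNoise_star_field (hZ : IsCARField Z) (Q : Op H) (ψ : H) :
    linearNoise Z e Q (star (Z ψ)) = star (noiseField Z Q ψ) := by
  rw [linearNoise, star_map_eq_sum_inner e (noiseField Z Q) ψ]
  refine Finset.sum_congr rfl fun j _ => ?_
  rw [hZ.gradedComm_star_field_star_field, hZ.gradedComm_field_star_field, map_smul, map_zero,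
    mul_zero, zero_add, embedRight_one, mul_smul_comm, mul_one]

theorem exists_norm_noiseField_le (Z : H →ₗ⋆[ℂ] Op K) (ψ : H) :
    ∃ C : ℝ, ∀ Q : Op H, ‖noiseField Z Q ψ‖ ≤ C * ‖Q‖ := by
  obtain ⟨C, hC0, hC⟩ := exists_norm_le Z
  refine ⟨C * ‖ψ‖ * ‖parityOp Z‖, fun Q => ?_⟩
  rw [noiseField_apply]
  calc _ ≤ ‖Z (-Q ψ)‖ * ‖parityOp Z‖ := norm_tensorOp_le _ _
    _ ≤ (C * (‖Q‖ * ‖ψ‖)) * ‖parityOp Z‖ := by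
        gcongr
        refine (hC _).trans ?_
        rw [norm_neg]
        gcongr
        exact Q.le_opNorm ψ
    _ = _ := by ring

theorem norm_star_op (X : Op K') : ‖star X‖ = ‖X‖ := norm_star X

theorem exists_norm_linearNoise_le (Z : H →ₗ⋆[ℂ] Op K) (X : Op K) :
    ∃ C : ℝ, ∀ Q : Op H, ‖linearNoise Z e Q X‖ ≤ C * ‖Q‖ := by
  choose C hC using fun j => exists_norm_noiseField_le Z (e j)
  refine ⟨∑ j, (C j * ‖embedRight (gradedComm Z (star (Z (e j))) X)‖
    + C j * ‖embedRight (gradedComm Z (Z (e j)) X)‖), fun Q => ?_⟩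
  rw [Finset.sum_mul]
  refine (norm_sum_le _ _).trans (Finset.sum_le_sum fun j _ => ?_)
  have h1 := norm_mul_le (noiseField Z Q (e j)) (embedRight (gradedComm Z (star (Z (e j))) X))
  have h2 := norm_mul_le (star (noiseField Z Q (e j))) (embedRight (gradedComm Z (Z (e j)) X))
  have h0 : ‖star (noiseField Z Q (e j))‖ = ‖noiseField Z Q (e j)‖ := norm_star_op _
  rw [h0] at h2
  have h3 := mul_le_mul_of_nonneg_right (hC j Q)
    (norm_nonneg (embedRight (gradedComm Z (star (Z (e j))) X)))
  have h4 := mul_le_mul_of_nonneg_right (hC j Q)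
    (norm_nonneg (embedRight (gradedComm Z (Z (e j)) X)))
  refine (norm_add_le _ _).trans ?_
  linarith

end Noise
-- Expectation over the noise
section Expectation

variable {Z : H →ₗ⋆[ℂ] Op K}

theorem IsCARField.star_modeProd (hZ : IsCARField Z) {ι : Type*} (μ : ι → ℝ) {e : ι → H}
    (he : Orthonormal ℂ e) {l : List ι} (hl : l.Nodup) :
    star (modeProd Z μ e l) = modeProd Z μ e l := by
  induction l with
  | nil => simp [modeProd]
  | cons a l ih =>
    obtain ⟨ha, hl⟩ := List.nodup_cons.1 hl
    have h1 := hZ.commute_modeProd μ he ha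
    have h2 := hZ.commute_modeProd_star μ he ha
    have h3 : Commute (modeProd Z μ e l) (modeFactor Z (μ a) (e a)) :=
      ((h1.mul_right h2).smul_right _).add_right ((h2.mul_right h1).smul_right _)
    rw [modeProd_cons, star_mul, star_modeFactor, ih hl, h3.eq]

theorem IsCARField.star_gaussianDensity (hZ : IsCARField Z) {Q : Op H}
    (hQ : (Q : H →ₗ[ℂ] H).IsSymmetric) : star (gaussianDensity Z Q) = gaussianDensity Z Q := by
  rw [gaussianDensity_eq Z hQ]
  exact hZ.star_modeProd _ (hQ.eigenvectorBasis rfl).orthonormal (List.nodup_finRange _)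

theorem IsCARField.tau_gaussianDensity_mul_field (hZ : IsCARField Z) {Q : Op H}
    (hQ : (Q : H →ₗ[ℂ] H).IsSymmetric) (ψ : H) : tau (gaussianDensity Z Q * Z ψ) = 0 := by
  have hc := hZ.commute_numberOp_modeProd (hQ.eigenvalues rfl) (hQ.eigenvectorBasis rfl)
    (List.finRange _)
  rw [← gaussianDensity_eq] at hc
  have h1 : Z ψ = Z ψ * numberOp Z - numberOp Z * Z ψ := by
    have h := hZ.secondQuant_comm 1 ψ
    rw [star_one, one_apply_eq_self] at h
    rw [numberOp, ← neg_sub, h, neg_neg]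
  have h3 : tau (gaussianDensity Z Q * (numberOp Z * Z ψ))
      = tau (gaussianDensity Z Q * (Z ψ * numberOp Z)) := by
    rw [← mul_assoc, hc.eq, mul_assoc, tau_mul_comm, mul_assoc]
  rw [h1, mul_sub, tau_sub, h3, sub_self]

theorem tau_mul_star_eq {ρ : Op K} (hρ : star ρ = ρ) (X : Op K) :
    tau (ρ * star X) = star (tau (ρ * X)) := by
  rw [← tau_star, star_mul, hρ, tau_mul_comm]

/-- The expectation in the Gaussian state with symbol `T` of the left factor. -/
def noiseExpect (Z : H →ₗ⋆[ℂ] Op K) (T : Op H) : Op (K ⊗[ℂ] K) →ₗ[ℂ] Op K :=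
  partialTrace ∘ₗ LinearMap.mulLeft ℂ (tensorOp (gaussianDensity Z T) 1)

theorem noiseExpect_apply (Z : H →ₗ⋆[ℂ] Op K) (T : Op H) (Y : Op (K ⊗[ℂ] K)) :
    noiseExpect Z T Y = partialTrace (tensorOp (gaussianDensity Z T) 1 * Y) := rfl

theorem noiseExpect_tensorOp (Z : H →ₗ⋆[ℂ] Op K) (T : Op H) (A B : Op K) :
    noiseExpect Z T (tensorOp A B) = tau (gaussianDensity Z T * A) • B := by
  rw [noiseExpect_apply, ← tensorOp_mul, one_mul, partialTrace_tensorOp]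

theorem noiseExpect_mul_embedRight (Z : H →ₗ⋆[ℂ] Op K) (T : Op H) (Y : Op (K ⊗[ℂ] K)) (X : Op K) :
    noiseExpect Z T (Y * embedRight X) = noiseExpect Z T Y * X := by
  rw [noiseExpect_apply, ← mul_assoc, partialTrace_mul_embedRight, noiseExpect_apply]

/-- The density acts on the left factor only, so it commutes with the right copy, and the module
property of the partial trace applies. -/
theorem noiseExpect_embedRight_mul (Z : H →ₗ⋆[ℂ] Op K) (T : Op H) (Y : Op (K ⊗[ℂ] K)) (X : Op K) :
    noiseExpect Z T (embedRight X * Y) = X * noiseExpect Z T Y := by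
  have h : tensorOp (gaussianDensity Z T) 1 * embedRight X
      = embedRight X * tensorOp (gaussianDensity Z T) 1 := by
    rw [embedRight_apply, ← tensorOp_mul,
      ← tensorOp_mul, one_mul, one_mul, mul_one, mul_one]
  rw [noiseExpect_apply, ← mul_assoc, h, mul_assoc, partialTrace_embedRight_mul, noiseExpect_apply]

theorem IsCARField.noiseExpect_embedRight [Nontrivial K] (hZ : IsCARField Z) {T : Op H}
    (hT : (T : H →ₗ[ℂ] H).IsSymmetric) (X : Op K) : noiseExpect Z T (embedRight X) = X := by
  rw [embedRight_apply, noiseExpect_tensorOp, mul_one, hZ.tau_gaussianDensity hT, one_smul]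

theorem exists_norm_le_of_linear (f : Op K' →ₗ[ℂ] Op K) : ∃ C : ℝ, ∀ Y, ‖f Y‖ ≤ C * ‖Y‖ :=
  ⟨‖LinearMap.toContinuousLinearMap f‖, (LinearMap.toContinuousLinearMap f).le_opNorm⟩

theorem exists_norm_noiseExpect_le (Z : H →ₗ⋆[ℂ] Op K) :
    ∃ C : ℝ, ∀ T : Op H, 0 ≤ T → T ≤ 1 → ∀ Y, ‖noiseExpect Z T Y‖ ≤ C * ‖Y‖ := by
  obtain ⟨C, hC⟩ := exists_norm_le_of_linear (partialTrace (K := K))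
  obtain ⟨C', hC'⟩ := exists_norm_gaussianDensity_le Z
  refine ⟨|C| * (C' * ‖(1 : Op K)‖), fun T h0 h1 Y => ?_⟩
  have h2 : ‖tensorOp (gaussianDensity Z T) 1‖ ≤ C' * ‖(1 : Op K)‖ :=
    (norm_tensorOp_le _ _).trans (mul_le_mul_of_nonneg_right (hC' T h0 h1) (norm_nonneg _))
  have h3 := norm_mul_le (tensorOp (gaussianDensity Z T) 1) Y
  have h4 := mul_le_mul_of_nonneg_right h2 (norm_nonneg Y)
  have h5 := hC (tensorOp (gaussianDensity Z T) 1 * Y)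
  rw [noiseExpect_apply]
  calc _ ≤ C * ‖tensorOp (gaussianDensity Z T) 1 * Y‖ := h5
    _ ≤ |C| * ‖tensorOp (gaussianDensity Z T) 1 * Y‖ :=
        mul_le_mul_of_nonneg_right (le_abs_self C) (norm_nonneg _)
    _ ≤ |C| * (C' * ‖(1 : Op K)‖ * ‖Y‖) :=
        mul_le_mul_of_nonneg_left (h3.trans h4) (abs_nonneg C)
    _ = _ := by ring

theorem IsCARField.noiseExpect_noiseField (hZ : IsCARField Z) {T : Op H} (hT : (T : H →ₗ[ℂ] H).IsSymmetric)
    (Q : Op H) (ψ : H) : noiseExpect Z T (noiseField Z Q ψ) = 0 := by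
  rw [noiseField_apply, noiseExpect_tensorOp, hZ.tau_gaussianDensity_mul_field hT, zero_smul]

theorem IsCARField.noiseExpect_star_noiseField (hZ : IsCARField Z) {T : Op H} (hT : (T : H →ₗ[ℂ] H).IsSymmetric)
    (Q : Op H) (ψ : H) :
    noiseExpect Z T (star (noiseField Z Q ψ)) = 0 := by
  rw [hZ.star_noiseField, noiseExpect_tensorOp, tau_mul_star_eq (hZ.star_gaussianDensity hT),
    hZ.tau_gaussianDensity_mul_field hT, star_zero, zero_smul]

theorem IsCARField.noiseExpect_mul (hZ : IsCARField Z) {T : Op H} (hT : (T : H →ₗ[ℂ] H).IsSymmetric)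
    (Q : Op H) (ψ φ : H) :
    noiseExpect Z T (noiseField Z Q ψ * noiseField Z Q φ) = 0 := by
  rw [noiseField_apply, noiseField_apply, ← tensorOp_mul, noiseExpect_tensorOp,
    hZ.tau_gaussianDensity_mul_mul hT, zero_smul]

theorem IsCARField.noiseExpect_star_mul_star (hZ : IsCARField Z) {T : Op H} (hT : (T : H →ₗ[ℂ] H).IsSymmetric)
    (Q : Op H) (ψ φ : H) :
    noiseExpect Z T (star (noiseField Z Q ψ) * star (noiseField Z Q φ)) = 0 := by
  rw [hZ.star_noiseField, hZ.star_noiseField, ← tensorOp_mul, noiseExpect_tensorOp, ← star_mul,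
    tau_mul_star_eq (hZ.star_gaussianDensity hT), hZ.tau_gaussianDensity_mul_mul hT, star_zero,
    zero_smul]

theorem IsCARField.noiseExpect_mul_star [Nontrivial K] (hZ : IsCARField Z) {T : Op H} (hT : (T : H →ₗ[ℂ] H).IsSymmetric)
    (Q : Op H) (ψ φ : H) :
    noiseExpect Z T (noiseField Z Q ψ * star (noiseField Z Q φ))
      = (⟪Q ψ, Q φ⟫_ℂ - ⟪Q ψ, T (Q φ)⟫_ℂ) • (1 : Op K) := by
  rw [hZ.star_noiseField, noiseField_apply, ← tensorOp_mul, noiseExpect_tensorOp,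
    hZ.tau_gaussianDensity_mul_star hT, hZ.parityOp_mul_self]
  simp

theorem IsCARField.noiseExpect_star_mul [Nontrivial K] (hZ : IsCARField Z) {T : Op H} (hT : (T : H →ₗ[ℂ] H).IsSymmetric)
    (Q : Op H) (ψ φ : H) :
    noiseExpect Z T (star (noiseField Z Q φ) * noiseField Z Q ψ)
      = ⟪Q ψ, T (Q φ)⟫_ℂ • (1 : Op K) := by
  rw [hZ.star_noiseField, noiseField_apply, ← tensorOp_mul, noiseExpect_tensorOp,
    hZ.star_mul_eq, mul_sub, tau_sub, mul_smul_comm, tau_smul, mul_one, hZ.tau_gaussianDensity hT,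
    hZ.tau_gaussianDensity_mul_star hT, hZ.parityOp_mul_self]
  simp

/-- Moving all right operators to the right of the noise leaves products of two noise fields. By
gauge invariance only the mixed pairs, one field and one adjoint, survive. -/
theorem IsCARField.noiseExpect_linearNoise_mul [Nontrivial K] (hZ : IsCARField Z) {T : Op H} (hT : (T : H →ₗ[ℂ] H).IsSymmetric)
    (Q : Op H) {ι : Type*} [Fintype ι]
    (e : OrthonormalBasis ι ℂ H) (X Y : Op K) :
    noiseExpect Z T (linearNoise Z e Q X * linearNoise Z e Q Y) = ∑ j, ∑ k,
      ((⟪Q (e j), Q (e k)⟫_ℂ - ⟪Q (e j), T (Q (e k))⟫_ℂ) •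
          (parityConj Z (gradedComm Z (star (Z (e j))) X) * gradedComm Z (Z (e k)) Y)
        + ⟪Q (e k), T (Q (e j))⟫_ℂ •
          (parityConj Z (gradedComm Z (Z (e j)) X) * gradedComm Z (star (Z (e k))) Y)) := by
  have h1 : ∀ (a b : Op (K ⊗[ℂ] K)) (P R : Op K) (c : ℂ),
      embedRight P * b = b * embedRight (parityConj Z P) →
      noiseExpect Z T (a * b) = c • (1 : Op K) →
      noiseExpect Z T (a * embedRight P * (b * embedRight R)) = c • (parityConj Z P * R) := by
    intro a b P R c h h'
    have : a * embedRight P * (b * embedRight R) = a * b * embedRight (parityConj Z P * R) := by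
      rw [embedRight_mul, ← mul_assoc, mul_assoc a, h]
      simp only [mul_assoc]
    rw [this, noiseExpect_mul_embedRight, h', smul_mul_assoc, one_mul]
  have z0 : ∀ a : Op (K ⊗[ℂ] K), noiseExpect Z T a = 0 → noiseExpect Z T a = (0 : ℂ) • (1 : Op K) :=
    fun a h => by rw [h, zero_smul]
  rw [linearNoise, linearNoise, Finset.sum_mul, map_sum]
  refine Finset.sum_congr rfl fun j _ => ?_
  rw [Finset.mul_sum, map_sum]
  refine Finset.sum_congr rfl fun k _ => ?_
  rw [add_mul, mul_add, mul_add, map_add, map_add, map_add,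
    h1 _ _ _ _ _ (hZ.embedRight_mul_noiseField _ _ _) (z0 _ (hZ.noiseExpect_mul hT _ _ _)),
    h1 _ _ _ _ _ (hZ.embedRight_mul_star_noiseField _ _ _) (hZ.noiseExpect_mul_star hT _ _ _),
    h1 _ _ _ _ _ (hZ.embedRight_mul_noiseField _ _ _) (hZ.noiseExpect_star_mul hT _ _ _),
    h1 _ _ _ _ _ (hZ.embedRight_mul_star_noiseField _ _ _)
      (z0 _ (hZ.noiseExpect_star_mul_star hT _ _ _))]
  simp

end Expectation

/-! ### The dilated Heisenberg evolution -/

section Dilated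

variable {Z : H →ₗ⋆[ℂ] Op K}

theorem implementer_mem_unitary (Z : H → Op K) (U : Op H) : implementer Z U ∈ unitary (Op K) := by
  rw [implementer]
  split_ifs with h
  · exact h.choose_spec.1
  · exact one_mem _

/-- The Heisenberg evolution of the left copy of `X` under the dilation of `S`. -/
def dilated (Z : H →ₗ⋆[ℂ] Op K) (S : Op H) (X : Op K) : Op (K ⊗[ℂ] K) :=
  implementer (doubled Z) (dilation S) * embedLeft Z X *
    star (implementer (doubled Z) (dilation S))

theorem dilated_add (Z : H →ₗ⋆[ℂ] Op K) (S : Op H) (X Y : Op K) :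
    dilated Z S (X + Y) = dilated Z S X + dilated Z S Y := by
  simp only [dilated, map_add, mul_add, add_mul]

theorem dilated_smul (Z : H →ₗ⋆[ℂ] Op K) (S : Op H) (c : ℂ) (X : Op K) :
    dilated Z S (c • X) = c • dilated Z S X := by
  simp only [dilated, map_smul, mul_smul_comm, smul_mul_assoc]

theorem star_mul_self_implementer (Z : H → Op K) (U : Op H) :
    star (implementer Z U) * implementer Z U = 1 :=
  Unitary.star_mul_self_of_mem (implementer_mem_unitary Z U)

theorem mul_star_self_implementer (Z : H → Op K) (U : Op H) :
    implementer Z U * star (implementer Z U) = 1 :=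
  Unitary.mul_star_self_of_mem (implementer_mem_unitary Z U)

theorem IsCARField.dilated_one (hZ : IsCARField Z) (S : Op H) : dilated Z S 1 = 1 := by
  rw [dilated, hZ.embedLeft_one, mul_one, mul_star_self_implementer]

theorem IsCARField.dilated_mul (hZ : IsCARField Z) (S : Op H) (X Y : Op K) :
    dilated Z S (X * Y) = dilated Z S X * dilated Z S Y := by
  simp only [dilated, hZ.embedLeft_mul]
  set V := implementer (doubled Z) (dilation S) with hV
  have h : star V * V = 1 := star_mul_self_implementer _ _
  calc _ = V * embedLeft Z X * 1 * embedLeft Z Y * star V := by rw [mul_one]; simp only [mul_assoc]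
    _ = _ := by rw [← h]; simp only [mul_assoc]

theorem IsCARField.star_dilated (hZ : IsCARField Z) (S : Op H) (X : Op K) :
    star (dilated Z S X) = dilated Z S (star X) := by
  simp only [dilated, star_mul, star_star, hZ.star_embedLeft, mul_assoc]

/-- The first column of `U_S` sends `ψ ⊕ 0` to `-Qψ ⊕ S*ψ`: noise on the left, drift on the right.
-/
theorem IsCARField.dilated_field (hZ : IsCARField Z) {S : Op H} (hS : 0 ≤ 1 - S * star S) (ψ : H) :
    dilated Z S (Z ψ) = noiseField Z (CFC.sqrt (1 - S * star S)) ψ + embedRight (Z (star S ψ)) := by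
  have h := (hZ.doubledField.implementer_spec (star_dilation S) (dilation_mul_self hS)).2
    (WithLp.toLp 2 (ψ, 0))
  rw [coe_doubledField] at h
  rw [dilated, hZ.embedLeft_field, h, dilation_apply, doubled_apply, noiseField_apply,
    embedRight_apply]
  simp only [WithLp.toLp_fst, WithLp.toLp_snd, map_zero, add_zero]

theorem IsCARField.ehkDual_eq (hZ : IsCARField Z) {S R : Op H}
    (hT : (ancillaSymbol S R : H →ₗ[ℂ] H).IsSymmetric) (X : Op K) :
    ehkDual Z S R X = noiseExpect Z (ancillaSymbol S R) (dilated Z S X) := by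
  rw [ehkDual_apply, hZ.gaussianDensity_doubled hT, star_tensorOp, hZ.star_gaussianDensity hT,
    star_one, noiseExpect_apply, dilated]

end Dilated
-- The Lindblad generator on products and on fields
section Generator

variable {Z : H →ₗ⋆[ℂ] Op K}

/-- The Lindblad generator with noise vectors `φ`, occupation numbers `lam` and Hamiltonian part
given by the second quantization of `B`. -/
def lindblad {κ : Type*} [Fintype κ] (Z : H → Op K) (lam : κ → ℝ) (φ : κ → H) (B : Op H)
    (X : Op K) : Op K :=
  ∑ j, ((1 - lam j : ℝ) : ℂ) • dissipator Z (Z (φ j)) X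
    + ∑ j, ((lam j : ℝ) : ℂ) • dissipator Z (star (Z (φ j))) X
    - Complex.I • (secondQuant Z B * X - X * secondQuant Z B)

variable {κ : Type*} [Fintype κ] (lam : κ → ℝ) (φ : κ → H) (B : Op H)

theorem lindblad_add (Z : H → Op K) (X Y : Op K) :
    lindblad Z lam φ B (X + Y) = lindblad Z lam φ B X + lindblad Z lam φ B Y := by
  simp only [lindblad, dissipator_add, smul_add, Finset.sum_add_distrib, mul_add, add_mul, smul_sub]
  abel

theorem IsCARField.lindblad_smul_one (hZ : IsCARField Z) (c : ℂ) :
    lindblad Z lam φ B (c • 1) = 0 := by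
  simp [lindblad, dissipator_smul, hZ.dissipator_one]

theorem IsCARField.star_lindblad (hZ : IsCARField Z) (hB : star B = B) (X : Op K) :
    star (lindblad Z lam φ B X) = lindblad Z lam φ B (star X) := by
  have h : star (secondQuant Z B) = secondQuant Z B := by rw [star_secondQuant, hB]
  simp only [lindblad, star_sub, star_add, star_sum, star_smul, hZ.star_dissipator, star_mul, h]
  simp
  module

/-- Being linear in one slot and conjugate linear in the other, the sum depends on the vectors only
through the operator `∑ c_l |φ_l⟩⟨φ_l|`. -/
theorem sum_sandwich {ι : Type*} [Fintype ι] (e : OrthonormalBasis ι ℂ H) (c : κ → ℂ)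
    (f : H →ₗ[ℂ] Op K) (g : H →ₗ⋆[ℂ] Op K) :
    ∑ l, c l • (f (φ l) * g (φ l))
      = ∑ j, ∑ k, (∑ l, c l * (⟪e j, φ l⟫_ℂ * ⟪φ l, e k⟫_ℂ)) • (f (e j) * g (e k)) := by
  have h1 : ∀ l, f (φ l) = ∑ j, ⟪e j, φ l⟫_ℂ • f (e j) := fun l => by
    conv_lhs => rw [← e.sum_repr' (φ l)]
    simp [map_sum]
  have h2 : ∀ l, c l • (f (φ l) * g (φ l))
      = ∑ j, ∑ k, (c l * (⟪e j, φ l⟫_ℂ * ⟪φ l, e k⟫_ℂ)) • (f (e j) * g (e k)) := fun l => by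
    rw [h1 l, map_eq_sum_inner e g (φ l), Finset.sum_mul, Finset.smul_sum]
    refine Finset.sum_congr rfl fun j _ => ?_
    rw [Finset.mul_sum, Finset.smul_sum]
    refine Finset.sum_congr rfl fun k _ => ?_
    rw [smul_mul_smul_comm, smul_smul]
  simp only [h2, Finset.sum_smul]
  rw [Finset.sum_comm]
  exact Finset.sum_congr rfl fun j _ => Finset.sum_comm

/-- The Hamiltonian part is a derivation and cancels; only the carré du champ of each dissipator is
left, rewritten in a fixed basis so that it can be matched with the noise covariance. -/
theorem IsCARField.lindblad_mul (hZ : IsCARField Z) {ι : Type*} [Fintype ι]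
    (e : OrthonormalBasis ι ℂ H) (D A : Op H)
    (h0 : ∀ a b, ∑ l, ((1 - lam l : ℝ) : ℂ) * (⟪a, φ l⟫_ℂ * ⟪φ l, b⟫_ℂ) = ⟪a, D b⟫_ℂ - ⟪a, A b⟫_ℂ)
    (h1 : ∀ a b, ∑ l, ((lam l : ℝ) : ℂ) * (⟪a, φ l⟫_ℂ * ⟪φ l, b⟫_ℂ) = ⟪a, A b⟫_ℂ) (X Y : Op K) :
    lindblad Z lam φ B (X * Y) = lindblad Z lam φ B X * Y + X * lindblad Z lam φ B Y + ∑ j, ∑ k,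
      ((⟪e j, D (e k)⟫_ℂ - ⟪e j, A (e k)⟫_ℂ) •
          (parityConj Z (gradedComm Z (star (Z (e j))) X) * gradedComm Z (Z (e k)) Y)
        + ⟪e k, A (e j)⟫_ℂ •
          (parityConj Z (gradedComm Z (Z (e j)) X) * gradedComm Z (star (Z (e k))) Y)) := by
  have hodd : ∀ ψ, parityConj Z (Z ψ) = -Z ψ := hZ.parity_conj_field
  have hodd' : ∀ ψ, parityConj Z (star (Z ψ)) = -star (Z ψ) := hZ.parity_conj_star_field
  let f : Op K → H →ₗ[ℂ] Op K := fun X =>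
    { toFun := fun ψ => gradedComm Z (star (Z ψ)) X
      map_add' := fun a b => by simp only [gradedComm, map_add, star_add, add_mul, mul_add]; abel
      map_smul' := fun c a => by
        simp only [gradedComm, LinearMap.map_smulₛₗ, star_smul, smul_mul_assoc, mul_smul_comm,
          smul_sub]
        simp }
  let g : Op K → H →ₗ⋆[ℂ] Op K := fun X =>
    { toFun := fun ψ => gradedComm Z (Z ψ) X
      map_add' := fun a b => by simp only [gradedComm, map_add, add_mul, mul_add]; abel
      map_smul' := fun c a => by
        simp only [gradedComm, LinearMap.map_smulₛₗ, smul_mul_assoc, mul_smul_comm, smul_sub] }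
  let pc : Op K →ₗ[ℂ] Op K :=
    { toFun := parityConj Z
      map_add' := parityConj_add Z
      map_smul' := parityConj_smul Z }
  have s1 := sum_sandwich φ e (fun l => ((1 - lam l : ℝ) : ℂ)) (pc ∘ₗ f X) (g Y)
  -- Here the first factor is conjugate linear and the second linear, so `sum_sandwich` does not
  -- apply directly and the indices come out exchanged.
  have s2 : ∑ l, ((lam l : ℝ) : ℂ) • (parityConj Z (gradedComm Z (Z (φ l)) X) *
      gradedComm Z (star (Z (φ l))) Y) = ∑ j, ∑ k, ⟪e k, A (e j)⟫_ℂ •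
          (parityConj Z (gradedComm Z (Z (e j)) X) * gradedComm Z (star (Z (e k))) Y) := by
    have h2 : ∀ l, ((lam l : ℝ) : ℂ) • (parityConj Z (gradedComm Z (Z (φ l)) X) *
        gradedComm Z (star (Z (φ l))) Y) = ∑ j, ∑ k,
          (((lam l : ℝ) : ℂ) * (⟪e k, φ l⟫_ℂ * ⟪φ l, e j⟫_ℂ)) •
          (parityConj Z (gradedComm Z (Z (e j)) X) * gradedComm Z (star (Z (e k))) Y) := fun l => by
      have a1 : parityConj Z (gradedComm Z (Z (φ l)) X)
          = ∑ j, ⟪φ l, e j⟫_ℂ • parityConj Z (gradedComm Z (Z (e j)) X) := by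
        have := congrArg pc (map_eq_sum_inner e (g X) (φ l))
        simp only [map_sum, map_smul] at this
        exact this
      have a2 : gradedComm Z (star (Z (φ l))) Y
          = ∑ k, ⟪e k, φ l⟫_ℂ • gradedComm Z (star (Z (e k))) Y := by
        have : f Y (φ l) = f Y (∑ k, ⟪e k, φ l⟫_ℂ • e k) := by rw [e.sum_repr' (φ l)]
        simp only [map_sum, map_smul] at this
        exact this
      rw [a1, a2, Finset.sum_mul, Finset.smul_sum]
      refine Finset.sum_congr rfl fun j _ => ?_
      rw [Finset.mul_sum, Finset.smul_sum]
      refine Finset.sum_congr rfl fun k _ => ?_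
      rw [smul_mul_smul_comm, smul_smul, mul_comm ⟪φ l, e j⟫_ℂ]
    simp only [h2]
    rw [Finset.sum_comm]
    refine Finset.sum_congr rfl fun j _ => ?_
    rw [Finset.sum_comm]
    refine Finset.sum_congr rfl fun k _ => ?_
    rw [← Finset.sum_smul, h1]
  simp only [h0] at s1
  simp only [Finset.sum_add_distrib]
  refine Eq.trans ?_ (congrArg₂ (fun a b => lindblad Z lam φ B X * Y + X * lindblad Z lam φ B Y +
    (a + b)) s1 s2)
  simp only [lindblad, hZ.dissipator_mul (hodd _), hZ.dissipator_mul (hodd' _), star_star, smul_add,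
    Finset.sum_add_distrib, add_mul, mul_add, sub_mul, mul_sub, Finset.sum_mul, Finset.mul_sum,
    smul_mul_assoc, mul_smul_comm, mul_assoc, smul_sub]
  simp only [pc, f, g, LinearMap.comp_apply, LinearMap.coe_mk, AddHom.coe_mk]
  abel

theorem star_hamiltonianPart (G : Op H) : star (hamiltonianPart G) = hamiltonianPart G := by
  rw [hamiltonianPart, star_smul, star_sub, star_star, ← neg_sub, smul_neg, ← neg_smul]
  congr 1
  simp [div_eq_mul_inv, mul_comm]

/-- The dissipators contribute `-½ Z(Dψ)`. The commutator contributes `i Z(Kψ) = Z(-iKψ)`, as `Z` is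
conjugate linear. Their sum is `Z(G*ψ)`, since `G* = -½D - iK`. -/
theorem IsCARField.lindblad_field (hZ : IsCARField Z) (D G : Op H)
    (hD : ∀ a b, ∑ l, ⟪a, φ l⟫_ℂ * ⟪φ l, b⟫_ℂ = ⟪a, D b⟫_ℂ) (hDG : D = -G - star G) (ψ : H) :
    lindblad Z lam φ (hamiltonianPart G) (Z ψ) = Z (star G ψ) := by
  have h1 : ∑ l, ⟪ψ, φ l⟫_ℂ • Z (φ l) = Z (D ψ) := by
    have : D ψ = ∑ l, ⟪φ l, ψ⟫_ℂ • φ l := ext_inner_left ℂ fun a => by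
      rw [← hD, inner_sum]
      refine Finset.sum_congr rfl fun l _ => ?_
      rw [inner_smul_right, mul_comm]
    rw [this, map_sum]
    simp
  rw [lindblad, hZ.secondQuant_comm, star_hamiltonianPart]
  simp only [hZ.dissipator_field, hZ.dissipator_star_field]
  rw [← Finset.sum_add_distrib]
  have h3 : ∀ l, ((1 - lam l : ℝ) : ℂ) • -((1 / 2 : ℂ) • ⟪ψ, φ l⟫_ℂ • Z (φ l))
      + ((lam l : ℝ) : ℂ) • -((1 / 2 : ℂ) • ⟪ψ, φ l⟫_ℂ • Z (φ l))
      = (-1 / 2 : ℂ) • (⟪ψ, φ l⟫_ℂ • Z (φ l)) := fun l => by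
    rw [← add_smul]
    push_cast
    module
  simp only [h3]
  rw [← Finset.smul_sum, h1]
  have h4 : star G ψ = (-1 / 2 : ℂ) • D ψ + (-Complex.I) • hamiltonianPart G ψ := by
    rw [hDG, hamiltonianPart]
    simp only [_root_.smul_apply, _root_.sub_apply, _root_.neg_apply, smul_smul]
    have : -Complex.I * (1 / (2 * Complex.I)) = -1 / 2 := by
      field_simp
    rw [this]
    module
  rw [h4, map_add, LinearMap.map_smulₛₗ, LinearMap.map_smulₛₗ]
  have h5 : (starRingEnd ℂ) 2 = 2 := map_ofNat _ 2
  simp [h5]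

end Generator

/-! ### First-order expansion in the noise -/

section FirstOrder

variable {Z : H →ₗ⋆[ℂ] Op K} {ι : Type*} [Fintype ι] {e : OrthonormalBasis ι ℂ H}
  {S Q T : ℝ → Op H}

/-- To first order in the noise, the dilated evolution of `X` is given by `linearNoise`. -/
def IsFirstOrder (Z : H →ₗ⋆[ℂ] Op K) (e : OrthonormalBasis ι ℂ H) (S Q : ℝ → Op H) (X : Op K) :
    Prop :=
  ∃ C : ℝ, ∀ᶠ t in 𝓝[>] (0 : ℝ),
    ‖dilated Z (S t) X - embedRight X - linearNoise Z e (Q t) X‖ ≤ C * t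

theorem exists_norm_linearNoise_le_sqrt (hQ : ∃ C : ℝ, ∀ᶠ t in 𝓝[>] (0 : ℝ), ‖Q t‖ ≤ C * √t)
    (X : Op K) : ∃ C : ℝ, ∀ᶠ t in 𝓝[>] (0 : ℝ), ‖linearNoise Z e (Q t) X‖ ≤ C * √t := by
  obtain ⟨C, hC⟩ := hQ
  obtain ⟨C', hC'⟩ := exists_norm_linearNoise_le e Z X
  refine ⟨|C'| * C, ?_⟩
  filter_upwards [hC] with t ht
  calc _ ≤ C' * ‖Q t‖ := hC' _
    _ ≤ |C'| * ‖Q t‖ := mul_le_mul_of_nonneg_right (le_abs_self _) (norm_nonneg _)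
    _ ≤ |C'| * (C * √t) := mul_le_mul_of_nonneg_left ht (abs_nonneg _)
    _ = _ := by ring

theorem IsFirstOrder.norm_sub_le {X : Op K} (hX : IsFirstOrder Z e S Q X)
    (hQ : ∃ C : ℝ, ∀ᶠ t in 𝓝[>] (0 : ℝ), ‖Q t‖ ≤ C * √t) :
    ∃ C : ℝ, ∀ᶠ t in 𝓝[>] (0 : ℝ), ‖dilated Z (S t) X - embedRight X‖ ≤ C * √t := by
  obtain ⟨C, hC⟩ := hX
  obtain ⟨C', hC'⟩ := exists_norm_linearNoise_le_sqrt (Z := Z) (e := e) hQ X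
  refine ⟨|C| + C', ?_⟩
  filter_upwards [hC, hC', Ioc_mem_nhdsGT (zero_lt_one' ℝ)] with t h1 h2 ht
  have h3 : t ≤ √t := Real.le_sqrt_of_sq_le (by nlinarith [ht.1, ht.2])
  have h4 := norm_add_le (dilated Z (S t) X - embedRight X - linearNoise Z e (Q t) X)
    (linearNoise Z e (Q t) X)
  rw [sub_add_cancel] at h4
  have h5 : C * t ≤ |C| * √t :=
    (mul_le_mul_of_nonneg_right (le_abs_self C) ht.1.le).trans
      (mul_le_mul_of_nonneg_left h3 (abs_nonneg C))
  linarith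

theorem IsFirstOrder.add {X Y : Op K} (hX : IsFirstOrder Z e S Q X) (hY : IsFirstOrder Z e S Q Y) :
    IsFirstOrder Z e S Q (X + Y) := by
  obtain ⟨C, hC⟩ := hX
  obtain ⟨C', hC'⟩ := hY
  refine ⟨C + C', ?_⟩
  filter_upwards [hC, hC'] with t h1 h2
  have h := norm_add_le (dilated Z (S t) X - embedRight X - linearNoise Z e (Q t) X)
    (dilated Z (S t) Y - embedRight Y - linearNoise Z e (Q t) Y)
  have h3 : dilated Z (S t) (X + Y) - embedRight (X + Y) - linearNoise Z e (Q t) (X + Y)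
      = (dilated Z (S t) X - embedRight X - linearNoise Z e (Q t) X)
        + (dilated Z (S t) Y - embedRight Y - linearNoise Z e (Q t) Y) := by
    rw [dilated_add, map_add, linearNoise_add]
    abel
  rw [h3]
  linarith

theorem IsCARField.isFirstOrder_smul_one (hZ : IsCARField Z) (c : ℂ) :
    IsFirstOrder Z e S Q (c • (1 : Op K)) := by
  refine ⟨0, Eventually.of_forall fun t => ?_⟩
  rw [dilated_smul, map_smul, hZ.linearNoise_smul_one, hZ.dilated_one, embedRight_one, sub_self,
    sub_zero, norm_zero, zero_mul]

/-- As `linearNoise` is a derivation, the only new error term is a product of two increments, of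
size `√t · √t = t`. -/
theorem IsCARField.isFirstOrder_mul (hZ : IsCARField Z)
    (hQ : ∃ C : ℝ, ∀ᶠ t in 𝓝[>] (0 : ℝ), ‖Q t‖ ≤ C * √t) {X Y : Op K}
    (hX : IsFirstOrder Z e S Q X) (hY : IsFirstOrder Z e S Q Y) :
    IsFirstOrder Z e S Q (X * Y) := by
  obtain ⟨C₁, h₁⟩ := hX.norm_sub_le hQ
  obtain ⟨C₂, h₂⟩ := hY.norm_sub_le hQ
  obtain ⟨C, hC⟩ := hX
  obtain ⟨C', hC'⟩ := hY
  refine ⟨C * ‖embedRight Y‖ + ‖embedRight X‖ * C' + C₁ * C₂, ?_⟩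
  filter_upwards [h₁, h₂, hC, hC', self_mem_nhdsWithin] with t g1 g2 g3 g4 ht
  have ht : 0 < t := ht
  set a := dilated Z (S t) X with ha
  set b := dilated Z (S t) Y with hb
  set n := linearNoise Z e (Q t) X with hn
  set m := linearNoise Z e (Q t) Y with hm
  have h3 : dilated Z (S t) (X * Y) - embedRight (X * Y) - linearNoise Z e (Q t) (X * Y)
      = (a - embedRight X - n) * embedRight Y + embedRight X * (b - embedRight Y - m)
        + (a - embedRight X) * (b - embedRight Y) := by
    rw [hZ.dilated_mul, embedRight_mul, hZ.linearNoise_mul]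
    noncomm_ring
  have e1 := (norm_mul_le (a - embedRight X - n) (embedRight Y)).trans
    (mul_le_mul_of_nonneg_right g3 (norm_nonneg _))
  have e2 := (norm_mul_le (embedRight X) (b - embedRight Y - m)).trans
    (mul_le_mul_of_nonneg_left g4 (norm_nonneg _))
  have e3 := (norm_mul_le (a - embedRight X) (b - embedRight Y)).trans
    (mul_le_mul g1 g2 (norm_nonneg _) ((norm_nonneg _).trans g1))
  have e4 : C₁ * √t * (C₂ * √t) = C₁ * C₂ * t := by
    rw [mul_mul_mul_comm, Real.mul_self_sqrt ht.le]
  have e5 := norm_add_le ((a - embedRight X - n) * embedRight Y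
    + embedRight X * (b - embedRight Y - m)) ((a - embedRight X) * (b - embedRight Y))
  have e6 := norm_add_le ((a - embedRight X - n) * embedRight Y)
    (embedRight X * (b - embedRight Y - m))
  rw [h3]
  calc _ ≤ C * t * ‖embedRight Y‖ + ‖embedRight X‖ * (C' * t) + C₁ * √t * (C₂ * √t) := by linarith
    _ = _ := by rw [e4]; ring

/-- The quadratic terms are to leading order given by the linear noise. -/
theorem IsFirstOrder.tendsto_noiseExpect_mul {X Y : Op K} (hX : IsFirstOrder Z e S Q X)
    (hY : IsFirstOrder Z e S Q Y) (hQ : ∃ C : ℝ, ∀ᶠ t in 𝓝[>] (0 : ℝ), ‖Q t‖ ≤ C * √t)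
    (hT : ∀ᶠ t in 𝓝[>] (0 : ℝ), 0 ≤ T t ∧ T t ≤ 1) :
    Tendsto (fun t : ℝ => (t : ℂ)⁻¹ • noiseExpect Z (T t)
      ((dilated Z (S t) X - embedRight X) * (dilated Z (S t) Y - embedRight Y)
        - linearNoise Z e (Q t) X * linearNoise Z e (Q t) Y)) (𝓝[>] 0) (𝓝 0) := by
  obtain ⟨C₂, h₂⟩ := hY.norm_sub_le hQ
  obtain ⟨C₁, h₁⟩ := exists_norm_linearNoise_le_sqrt (Z := Z) (e := e) hQ X
  obtain ⟨C, hC⟩ := hX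
  obtain ⟨C', hC'⟩ := hY
  obtain ⟨M, hM⟩ := exists_norm_noiseExpect_le Z
  have hlim : Tendsto (fun t : ℝ => |M| * (C * C₂ + C₁ * C') * √t) (𝓝[>] 0) (𝓝 0) := by
    have : Tendsto (fun t : ℝ => |M| * (C * C₂ + C₁ * C') * √t) (𝓝 0)
        (𝓝 (|M| * (C * C₂ + C₁ * C') * √0)) :=
      (continuous_const.mul Real.continuous_sqrt).tendsto 0
    rw [Real.sqrt_zero, mul_zero] at this
    exact this.mono_left nhdsWithin_le_nhds
  refine squeeze_zero_norm' ?_ hlim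
  filter_upwards [h₁, h₂, hC, hC', hT, self_mem_nhdsWithin] with t g1 g2 g3 g4 g5 ht
  have ht : 0 < t := ht
  set a := dilated Z (S t) X - embedRight X with ha
  set b := dilated Z (S t) Y - embedRight Y with hb
  set n := linearNoise Z e (Q t) X with hn
  set m := linearNoise Z e (Q t) Y with hm
  -- Each summand pairs an `O(t)` error with an `O(√t)` factor, so after division by `t` there
  -- remains `O(√t)`.
  have h3 : a * b - n * m = (a - n) * b + n * (b - m) := by noncomm_ring
  have e1 := (norm_mul_le (a - n) b).trans
    (mul_le_mul g3 g2 (norm_nonneg _) ((norm_nonneg _).trans g3))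
  have e2 := (norm_mul_le n (b - m)).trans
    (mul_le_mul g1 g4 (norm_nonneg _) ((norm_nonneg _).trans g1))
  have e3 := norm_add_le ((a - n) * b) (n * (b - m))
  have e4 : ‖a * b - n * m‖ ≤ (C * C₂ + C₁ * C') * √t * t := by
    rw [h3]
    calc _ ≤ C * t * (C₂ * √t) + C₁ * √t * (C' * t) := by linarith
      _ = _ := by ring
  have e5 : ‖noiseExpect Z (T t) (a * b - n * m)‖ ≤ |M| * ((C * C₂ + C₁ * C') * √t * t) :=
    (hM _ g5.1 g5.2 _).trans ((mul_le_mul_of_nonneg_right (le_abs_self M) (norm_nonneg _)).trans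
      (mul_le_mul_of_nonneg_left e4 (abs_nonneg M)))
  rw [norm_smul, norm_inv, Complex.norm_real, Real.norm_of_nonneg ht.le]
  calc _ ≤ t⁻¹ * (|M| * ((C * C₂ + C₁ * C') * √t * t)) :=
        mul_le_mul_of_nonneg_left e5 (inv_nonneg.2 ht.le)
    _ = _ := by field_simp

end FirstOrder
-- Differentiation at `t = 0`
section Limit

variable {Z : H →ₗ⋆[ℂ] Op K}

theorem two_smul_dissipativePart (G : Op H) : (2 : ℂ) • dissipativePart G = -G - star G := by
  rw [dissipativePart]
  module

theorem exists_norm_le_mul_of_tendsto {f : ℝ → Op H} {L : Op H}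
    (h : Tendsto (fun t : ℝ => (t : ℂ)⁻¹ • f t) (𝓝[>] 0) (𝓝 L)) :
    ∃ C : ℝ, 0 ≤ C ∧ ∀ᶠ t in 𝓝[>] (0 : ℝ), ‖f t‖ ≤ C * t := by
  refine ⟨‖L‖ + 1, by positivity, ?_⟩
  filter_upwards [h.norm.eventually_le_const (lt_add_one ‖L‖), self_mem_nhdsWithin] with t h1 ht
  have ht : 0 < t := ht
  rw [norm_smul, norm_inv, Complex.norm_real, Real.norm_of_nonneg ht.le] at h1
  rwa [inv_mul_le_iff₀ ht, mul_comm] at h1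

/-- The contraction `e^{tG}`. -/
def semigroup (G : Op H) (t : ℝ) : Op H := NormedSpace.exp ((t : ℂ) • G)

/-- The defect operator `(1 - e^{tG} e^{tG*})^{1/2}`. -/
def defect (G : Op H) (t : ℝ) : Op H :=
  CFC.sqrt (1 - semigroup G t * star (semigroup G t))

theorem one_sub_semigroup (G : Op H) (t : ℝ) :
    1 - semigroup G t * star (semigroup G t) = covarianceIntegral G (-G - star G) t :=
  one_sub_exp_mul_star G t

/-- The defect is itself the covariance integral of `-G - G*`, so compatibility of `R_t` is
positivity of the integral of the difference. -/
theorem covarianceIntegral_le {G A : Op H} (hAG : A ≤ -G - star G) {t : ℝ} (ht : 0 ≤ t) :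
    covarianceIntegral G A t ≤ 1 - semigroup G t * star (semigroup G t) := by
  rw [one_sub_semigroup, ← sub_nonneg, ← covarianceIntegral_sub]
  exact covarianceIntegral_nonneg G (sub_nonneg.2 hAG) ht

theorem exists_norm_defect_le {G : Op H} (hG : 0 ≤ -G - star G) :
    ∃ C : ℝ, ∀ᶠ t in 𝓝[>] (0 : ℝ), ‖defect G t‖ ≤ C * √t := by
  obtain ⟨C, hC0, hC⟩ := exists_norm_le_mul_of_tendsto
    (tendsto_inv_smul_covarianceIntegral G (-G - star G))
  refine ⟨√C, ?_⟩
  filter_upwards [hC, self_mem_nhdsWithin] with t h1 ht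
  have ht : 0 < t := ht
  have h2 := norm_sqrt_mul_self (covarianceIntegral_nonneg G hG ht.le)
  rw [defect, one_sub_semigroup, ← Real.sqrt_mul hC0]
  exact Real.le_sqrt_of_sq_le (by rw [sq, h2]; exact h1)

theorem ancillaSymbol_bounds {G A : Op H} (hA : 0 ≤ A) (hAG : A ≤ -G - star G) {t : ℝ}
    (ht : 0 ≤ t) : 0 ≤ ancillaSymbol (semigroup G t) (covarianceIntegral G A t) ∧
      ancillaSymbol (semigroup G t) (covarianceIntegral G A t) ≤ 1 :=
  ⟨invSqrt_conj_nonneg _ (covarianceIntegral_nonneg G hA ht),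
    invSqrt_conj_le_one (covarianceIntegral_nonneg G hA ht) (covarianceIntegral_le hAG ht)⟩

theorem isSymmetric_of_nonneg {T : Op H} (hT : 0 ≤ T) : (T : H →ₗ[ℂ] H).IsSymmetric :=
  ((ContinuousLinearMap.nonneg_iff_isPositive T).1 hT).isSymmetric

theorem inner_apply_of_isSelfAdjoint {B : Op H} (hB : IsSelfAdjoint B) (x y : H) :
    ⟪B x, y⟫_ℂ = ⟪x, B y⟫_ℂ := by
  rw [← ContinuousLinearMap.adjoint_inner_left, ← ContinuousLinearMap.star_eq_adjoint, hB.star_eq]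

theorem tendsto_inv_mul_inner {f : ℝ → Op H} {L : Op H}
    (h : Tendsto (fun t : ℝ => (t : ℂ)⁻¹ • f t) (𝓝[>] 0) (𝓝 L)) (x y : H) :
    Tendsto (fun t : ℝ => (t : ℂ)⁻¹ * ⟪x, f t y⟫_ℂ) (𝓝[>] 0) (𝓝 ⟪x, L y⟫_ℂ) := by
  have hc : Continuous fun B : Op H => ⟪x, B y⟫_ℂ := by fun_prop
  refine ((hc.tendsto L).comp h).congr fun t => ?_
  simp

/-- The fluctuation part of the quadratic noise terms in the limit. -/
theorem IsCARField.tendsto_noiseExpect_linearNoise [Nontrivial K] (hZ : IsCARField Z) {G A : Op H}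
    (hA : 0 ≤ A) (hAG : A ≤ -G - star G) {ι : Type*} [Fintype ι] (e : OrthonormalBasis ι ℂ H)
    (X Y : Op K) :
    Tendsto (fun t : ℝ => (t : ℂ)⁻¹ •
      noiseExpect Z (ancillaSymbol (semigroup G t) (covarianceIntegral G A t))
        (linearNoise Z e (defect G t) X * linearNoise Z e (defect G t) Y)) (𝓝[>] 0)
      (𝓝 (∑ j, ∑ k, ((⟪e j, (-G - star G) (e k)⟫_ℂ - ⟪e j, A (e k)⟫_ℂ) •
          (parityConj Z (gradedComm Z (star (Z (e j))) X) * gradedComm Z (Z (e k)) Y)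
        + ⟪e k, A (e j)⟫_ℂ •
          (parityConj Z (gradedComm Z (Z (e j)) X) * gradedComm Z (star (Z (e k))) Y)))) := by
  have hlim : Tendsto (fun t : ℝ => ∑ j, ∑ k,
      (((t : ℂ)⁻¹ * ⟪e j, covarianceIntegral G (-G - star G) t (e k)⟫_ℂ
          - (t : ℂ)⁻¹ * ⟪e j, covarianceIntegral G A t (e k)⟫_ℂ) •
          (parityConj Z (gradedComm Z (star (Z (e j))) X) * gradedComm Z (Z (e k)) Y)
        + ((t : ℂ)⁻¹ * ⟪e k, covarianceIntegral G A t (e j)⟫_ℂ) •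
          (parityConj Z (gradedComm Z (Z (e j)) X) * gradedComm Z (star (Z (e k))) Y)))
      (𝓝[>] 0) (𝓝 (∑ j, ∑ k, ((⟪e j, (-G - star G) (e k)⟫_ℂ - ⟪e j, A (e k)⟫_ℂ) •
          (parityConj Z (gradedComm Z (star (Z (e j))) X) * gradedComm Z (Z (e k)) Y)
        + ⟪e k, A (e j)⟫_ℂ •
          (parityConj Z (gradedComm Z (Z (e j)) X) * gradedComm Z (star (Z (e k))) Y)))) := by
    have hD := tendsto_inv_mul_inner (tendsto_inv_smul_covarianceIntegral G (-G - star G))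
    have hR := tendsto_inv_mul_inner (tendsto_inv_smul_covarianceIntegral G A)
    exact tendsto_finsetSum _ fun j _ => tendsto_finsetSum _ fun k _ =>
      (((hD _ _).sub (hR _ _)).smul_const _).add ((hR _ _).smul_const _)
  refine hlim.congr' ?_
  filter_upwards [self_mem_nhdsWithin] with t ht
  have ht : 0 < t := ht
  have hR0 := covarianceIntegral_nonneg G hA ht.le
  have hRD := covarianceIntegral_le hAG ht.le
  have hQ : IsSelfAdjoint (defect G t) := isSelfAdjoint_sqrt _
  have h1 : ∀ x y, ⟪defect G t x, defect G t y⟫_ℂ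
      = ⟪x, covarianceIntegral G (-G - star G) t y⟫_ℂ := fun x y => by
    rw [inner_apply_of_isSelfAdjoint hQ, ← one_sub_semigroup,
      ← CFC.sqrt_mul_sqrt_self _ (hR0.trans hRD)]
    rfl
  -- Sandwiched between two defects the ancilla symbol collapses to `R_t`, whose derivative at `0`
  -- is `A`.
  have h2 : ∀ x y, ⟪defect G t x, ancillaSymbol (semigroup G t) (covarianceIntegral G A t)
      (defect G t y)⟫_ℂ = ⟪x, covarianceIntegral G A t y⟫_ℂ := fun x y => by
    rw [inner_apply_of_isSelfAdjoint hQ]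
    conv_rhs => rw [← sqrt_conj_invSqrt_conj hR0 hRD]
    rfl
  rw [hZ.noiseExpect_linearNoise_mul
    (isSymmetric_of_nonneg (ancillaSymbol_bounds hA hAG ht.le).1), Finset.smul_sum]
  refine Finset.sum_congr rfl fun j _ => ?_
  rw [Finset.smul_sum]
  refine Finset.sum_congr rfl fun k _ => ?_
  rw [h1, h2, h2, smul_add, smul_smul, smul_smul, mul_sub]

theorem IsCARField.tendsto_inv_smul_field (G : Op H) (ψ : H) :
    Tendsto (fun t : ℝ => (t : ℂ)⁻¹ • (Z (star (semigroup G t) ψ) - Z ψ)) (𝓝[>] 0)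
      (𝓝 (Z (star G ψ))) := by
  obtain ⟨C, hC0, hC⟩ := exists_norm_le Z
  have hcont : Continuous fun ψ => Z ψ :=
    (LipschitzWith.of_dist_le_mul (K := ⟨C, hC0⟩) fun x y => by
      rw [dist_eq_norm, dist_eq_norm, ← map_sub]
      exact hC _).continuous
  have h1 := tendsto_inv_smul_exp_sub_one (star G)
  have h2 : Continuous fun B : Op H => Z (B ψ) := hcont.comp (by fun_prop)
  refine ((h2.tendsto (star G)).comp h1).congr fun t => ?_
  rw [semigroup, star_exp_smul]
  simp

theorem exists_norm_star_semigroup_sub_le (G : Op H) :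
    ∃ C : ℝ, 0 ≤ C ∧ ∀ᶠ t in 𝓝[>] (0 : ℝ), ‖star (semigroup G t) - 1‖ ≤ C * t := by
  obtain ⟨C, hC0, hC⟩ := exists_norm_le_mul_of_tendsto (tendsto_inv_smul_exp_sub_one (star G))
  refine ⟨C, hC0, hC.mono fun t ht => ?_⟩
  rwa [semigroup, star_exp_smul]

/-- On fields the noise part is exactly linear; the remainder is the drift `Z((S* - 1)ψ)`, of order
`t`. -/
theorem IsCARField.isFirstOrder_field (hZ : IsCARField Z) {G : Op H} (hG : 0 ≤ -G - star G)
    {ι : Type*} [Fintype ι] (e : OrthonormalBasis ι ℂ H) (ψ : H) :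
    IsFirstOrder Z e (semigroup G) (defect G) (Z ψ) ∧
      IsFirstOrder Z e (semigroup G) (defect G) (star (Z ψ)) := by
  obtain ⟨C, hC0, hC⟩ := exists_norm_le Z
  obtain ⟨C', hC0', hC'⟩ := exists_norm_star_semigroup_sub_le G
  have hb : ∀ᶠ t in 𝓝[>] (0 : ℝ), ‖Z (star (semigroup G t) ψ) - Z ψ‖ ≤ C * (C' * t * ‖ψ‖) := by
    filter_upwards [hC'] with t h1
    rw [← map_sub]
    refine (hC _).trans (mul_le_mul_of_nonneg_left ?_ hC0)
    have := (star (semigroup G t) - 1).le_opNorm ψ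
    rw [_root_.sub_apply, one_apply_eq_self] at this
    exact this.trans (mul_le_mul_of_nonneg_right h1 (norm_nonneg _))
  have hS : ∀ t : ℝ, 0 < t → 0 ≤ 1 - semigroup G t * star (semigroup G t) := fun t ht => by
    rw [one_sub_semigroup]
    exact covarianceIntegral_nonneg G hG ht.le
  refine ⟨⟨‖(1 : Op K)‖ * (C * (C' * ‖ψ‖)), ?_⟩, ⟨‖(1 : Op K)‖ * (C * (C' * ‖ψ‖)), ?_⟩⟩
  · filter_upwards [hb, self_mem_nhdsWithin] with t h1 ht
    have h2 : dilated Z (semigroup G t) (Z ψ) - embedRight (Z ψ)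
        - linearNoise Z e (defect G t) (Z ψ)
          = tensorOp 1 (Z (star (semigroup G t) ψ) - Z ψ) := by
      rw [hZ.dilated_field (hS t ht), hZ.linearNoise_field, defect, sub_right_comm,
        add_sub_cancel_left, ← map_sub]
      rfl
    rw [h2]
    calc _ ≤ ‖(1 : Op K)‖ * ‖Z (star (semigroup G t) ψ) - Z ψ‖ := norm_tensorOp_le _ _
      _ ≤ ‖(1 : Op K)‖ * (C * (C' * t * ‖ψ‖)) := by gcongr
      _ = _ := by ring
  · filter_upwards [hb, self_mem_nhdsWithin] with t h1 ht
    have h2 : dilated Z (semigroup G t) (star (Z ψ)) - embedRight (star (Z ψ))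
        - linearNoise Z e (defect G t) (star (Z ψ))
          = tensorOp 1 (star (Z (star (semigroup G t) ψ) - Z ψ)) := by
      rw [← hZ.star_dilated, hZ.dilated_field (hS t ht), hZ.linearNoise_star_field, star_add,
        star_embedRight, defect, sub_right_comm, add_sub_cancel_left, ← map_sub, ← star_sub]
      rfl
    rw [h2]
    calc _ ≤ ‖(1 : Op K)‖ * ‖star (Z (star (semigroup G t) ψ) - Z ψ)‖ := norm_tensorOp_le _ _
      _ = ‖(1 : Op K)‖ * ‖Z (star (semigroup G t) ψ) - Z ψ‖ := by rw [norm_star]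
      _ ≤ ‖(1 : Op K)‖ * (C * (C' * t * ‖ψ‖)) := by gcongr
      _ = _ := by ring

/-- The derivative of the dual semigroup is the Lindblad generator, in terms of noise vectors
which resolve `D = -G - G*` and `A`. -/
theorem IsCARField.tendsto_noiseExpect_dilated (hZ : IsCARField Z) (hirr : ActsIrreducibly Z)
    {G A : Op H} (hA : 0 ≤ A) (hAG : A ≤ -G - star G) {κ : Type*} [Fintype κ] (lam : κ → ℝ)
    (φ : κ → H)
    (h0 : ∀ a b, ∑ l, ⟪a, φ l⟫_ℂ * ⟪φ l, b⟫_ℂ = ⟪a, (-G - star G) b⟫_ℂ)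
    (h1 : ∀ a b, ∑ l, ((lam l : ℝ) : ℂ) * (⟪a, φ l⟫_ℂ * ⟪φ l, b⟫_ℂ) = ⟪a, A b⟫_ℂ) (X : Op K) :
    Tendsto (fun t : ℝ => (t : ℂ)⁻¹ •
      (noiseExpect Z (ancillaSymbol (semigroup G t) (covarianceIntegral G A t))
        (dilated Z (semigroup G t) X) - X)) (𝓝[>] 0)
      (𝓝 (lindblad Z lam φ (hamiltonianPart G) X)) := by
  have := hirr.1
  have hG : 0 ≤ -G - star G := hA.trans hAG
  have hQ := exists_norm_defect_le hG
  set e := stdOrthonormalBasis ℂ H with he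
  set T : ℝ → Op H := fun t => ancillaSymbol (semigroup G t) (covarianceIntegral G A t) with hT
  have hTb : ∀ᶠ t in 𝓝[>] (0 : ℝ), 0 ≤ T t ∧ T t ≤ 1 := by
    filter_upwards [self_mem_nhdsWithin] with t ht
    exact ancillaSymbol_bounds hA hAG (le_of_lt ht)
  have hTs : ∀ᶠ t in 𝓝[>] (0 : ℝ), (T t : H →ₗ[ℂ] H).IsSymmetric :=
    hTb.mono fun t ht => isSymmetric_of_nonneg ht.1
  have hS : ∀ t : ℝ, 0 < t → 0 ≤ 1 - semigroup G t * star (semigroup G t) := fun t ht => by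
    rw [one_sub_semigroup]
    exact covarianceIntegral_nonneg G hG ht.le
  have h0' : ∀ a b, ∑ l, ((1 - lam l : ℝ) : ℂ) * (⟪a, φ l⟫_ℂ * ⟪φ l, b⟫_ℂ)
      = ⟪a, (-G - star G) b⟫_ℂ - ⟪a, A b⟫_ℂ := fun a b => by
    rw [← h0, ← h1, ← Finset.sum_sub_distrib]
    refine Finset.sum_congr rfl fun l _ => ?_
    push_cast
    ring
  have hL : ∀ ψ, lindblad Z lam φ (hamiltonianPart G) (Z ψ) = Z (star G ψ) :=
    hZ.lindblad_field lam φ _ G h0 rfl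
  have hL' : ∀ ψ, lindblad Z lam φ (hamiltonianPart G) (star (Z ψ)) = star (Z (star G ψ)) :=
    fun ψ => by rw [← hZ.star_lindblad _ _ _ (star_hamiltonianPart G), hL]
  -- The expansion and the derivative are proved together, since the product step needs the
  -- expansion of both factors to reduce the quadratic term to its linear noise.
  have key : ∀ X ∈ Algebra.adjoin ℂ ({X | ∃ ψ, X = Z ψ ∨ X = star (Z ψ)} : Set (Op K)),
      IsFirstOrder Z e (semigroup G) (defect G) X ∧
      Tendsto (fun t : ℝ => (t : ℂ)⁻¹ • (noiseExpect Z (T t) (dilated Z (semigroup G t) X) - X))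
        (𝓝[>] 0) (𝓝 (lindblad Z lam φ (hamiltonianPart G) X)) := by
    intro X hX
    induction hX using Algebra.adjoin_induction with
    | mem X hX =>
      obtain ⟨ψ, rfl | rfl⟩ := hX
      · refine ⟨(hZ.isFirstOrder_field hG e ψ).1, ?_⟩
        rw [hL]
        refine (IsCARField.tendsto_inv_smul_field G ψ).congr' ?_
        filter_upwards [hTs, self_mem_nhdsWithin] with t ht htpos
        rw [hZ.dilated_field (hS t htpos), map_add, hZ.noiseExpect_noiseField ht,
          hZ.noiseExpect_embedRight ht, zero_add]
      · refine ⟨(hZ.isFirstOrder_field hG e ψ).2, ?_⟩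
        rw [hL']
        refine ((IsCARField.tendsto_inv_smul_field G ψ).star).congr' ?_
        filter_upwards [hTs, self_mem_nhdsWithin] with t ht htpos
        rw [← hZ.star_dilated, hZ.dilated_field (hS t htpos), star_add, map_add,
          hZ.noiseExpect_star_noiseField ht, star_embedRight, hZ.noiseExpect_embedRight ht,
          zero_add, star_smul, star_sub]
        simp
    | algebraMap c =>
      rw [Algebra.algebraMap_eq_smul_one]
      refine ⟨hZ.isFirstOrder_smul_one c, ?_⟩
      rw [hZ.lindblad_smul_one]
      refine tendsto_const_nhds.congr' ?_
      filter_upwards [hTs] with t ht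
      rw [dilated_smul, map_smul, hZ.dilated_one, ← embedRight_one, hZ.noiseExpect_embedRight ht,
        sub_self, smul_zero]
    | add X Y _ _ hX hY =>
      refine ⟨hX.1.add hY.1, ?_⟩
      rw [lindblad_add]
      refine (hX.2.add hY.2).congr fun t => ?_
      rw [dilated_add, map_add, ← smul_add]
      congr 1
      abel
    | mul X Y _ _ hX hY =>
      refine ⟨hZ.isFirstOrder_mul hQ hX.1 hY.1, ?_⟩
      rw [hZ.lindblad_mul lam φ _ e _ A h0' h1]
      have hrem := hX.1.tendsto_noiseExpect_mul hY.1 hQ hTb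
      have hmain := hZ.tendsto_noiseExpect_linearNoise hA hAG e X Y
      have hsum := ((hX.2.mul_const Y).add (hY.2.const_mul X)).add (hmain.add hrem)
      rw [add_zero] at hsum
      refine hsum.congr' ?_
      filter_upwards [hTs] with t ht
      set a := dilated Z (semigroup G t) X with ha
      set b := dilated Z (semigroup G t) Y with hb
      -- Only the first term escapes the bimodule property of the expectation; it yields the carré
      -- du champ, the others the Leibniz terms.
      have e1 : a * b = (a - embedRight X) * (b - embedRight Y) + a * embedRight Y
          + embedRight X * b - embedRight X * embedRight Y := by noncomm_ring
      have e2 : noiseExpect Z (T t) (a * b)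
          = noiseExpect Z (T t) ((a - embedRight X) * (b - embedRight Y))
            + noiseExpect Z (T t) a * Y + X * noiseExpect Z (T t) b - X * Y := by
        rw [e1, ← embedRight_mul, map_sub, map_add, map_add, noiseExpect_mul_embedRight,
          noiseExpect_embedRight_mul, hZ.noiseExpect_embedRight ht]
      rw [hZ.dilated_mul, ← ha, ← hb, e2, map_sub (noiseExpect Z (T t)), ← smul_add, add_sub_cancel,
        smul_mul_assoc, mul_smul_comm, ← smul_add, ← smul_add]
      congr 1
      noncomm_ring
  exact (key X (by rw [hirr.adjoin_eq_top]; trivial)).2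

end Limit
-- Noise vectors resolving `2H` and `A`
section Resolution

open scoped ComplexOrder in
/-- The eigenvalues of an operator between `0` and `1` lie between `0` and `1`. -/
theorem eigenvalue_bounds {T : Op H} (h0 : 0 ≤ T) (h1 : T ≤ 1) {x : H} (hx : ‖x‖ = 1) {r : ℝ}
    (hr : T x = (r : ℂ) • x) : 0 ≤ r ∧ r ≤ 1 := by
  have hin : ⟪x, T x⟫_ℂ = (r : ℂ) := by
    rw [hr, inner_smul_right, inner_self_eq_norm_sq_to_K, hx]
    simp
  constructor
  · have := ((ContinuousLinearMap.nonneg_iff_isPositive T).1 h0).inner_nonneg_right x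
    rw [hin] at this
    exact_mod_cast this
  · have := ((ContinuousLinearMap.le_def _ _).1 h1).inner_nonneg_right x
    rw [_root_.sub_apply, inner_sub_right, hin, one_apply_eq_self, inner_self_eq_norm_sq_to_K,
      hx] at this
    have h2 : (0 : ℂ) ≤ ((1 - r : ℝ) : ℂ) := by simpa using this
    have h3 : 0 ≤ 1 - r := by exact_mod_cast h2
    linarith

theorem sum_inner_sqrt {κ : Type*} [Fintype κ] {D : Op H} (hD : 0 ≤ D)
    (η : OrthonormalBasis κ ℂ H) (a b : H) :
    ∑ l, ⟪a, CFC.sqrt D (η l)⟫_ℂ * ⟪CFC.sqrt D (η l), b⟫_ℂ = ⟪a, D b⟫_ℂ := by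
  have hQ := isSelfAdjoint_sqrt D
  have h : ∀ l, ⟪a, CFC.sqrt D (η l)⟫_ℂ * ⟪CFC.sqrt D (η l), b⟫_ℂ
      = ⟪CFC.sqrt D a, η l⟫_ℂ * ⟪η l, CFC.sqrt D b⟫_ℂ := fun l => by
    rw [inner_apply_of_isSelfAdjoint hQ, inner_apply_of_isSelfAdjoint hQ]
  rw [Finset.sum_congr rfl fun l _ => h l, η.sum_inner_mul_inner,
    inner_apply_of_isSelfAdjoint hQ]
  conv_rhs => rw [← CFC.sqrt_mul_sqrt_self D hD]
  rfl

/-- The spectral resolution `T = ∑ λ_l |η_l⟩⟨η_l|`, conjugated by `D^{1/2}`. -/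
theorem sum_inner_sqrt_eigenvalue {κ : Type*} [Fintype κ] {A D T : Op H} (hT : 0 ≤ T)
    (hA : CFC.sqrt D * T * CFC.sqrt D = A) (η : OrthonormalBasis κ ℂ H) (lam : κ → ℝ)
    (hη : ∀ j, T (η j) = (lam j : ℂ) • η j) (a b : H) :
    ∑ l, ((lam l : ℝ) : ℂ) * (⟪a, CFC.sqrt D (η l)⟫_ℂ * ⟪CFC.sqrt D (η l), b⟫_ℂ)
      = ⟪a, A b⟫_ℂ := by
  have hQ := isSelfAdjoint_sqrt D
  have h : ∀ l, ((lam l : ℝ) : ℂ) * (⟪a, CFC.sqrt D (η l)⟫_ℂ * ⟪CFC.sqrt D (η l), b⟫_ℂ)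
      = ⟪CFC.sqrt D a, η l⟫_ℂ * ⟪η l, T (CFC.sqrt D b)⟫_ℂ := fun l => by
    rw [← inner_apply_of_isSelfAdjoint (IsSelfAdjoint.of_nonneg hT) (η l), hη, inner_smul_left,
      inner_apply_of_isSelfAdjoint hQ, inner_apply_of_isSelfAdjoint hQ, Complex.conj_ofReal]
    ring
  rw [Finset.sum_congr rfl fun l _ => h l, η.sum_inner_mul_inner,
    inner_apply_of_isSelfAdjoint hQ, ← hA]
  rfl

end Resolution

end General

end

end CAR

/-! ### Conclusion -/

theorem theorem4p4 {H K : Type*}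
    [NormedAddCommGroup H] [InnerProductSpace ℂ H] [FiniteDimensional ℂ H]
    [NormedAddCommGroup K] [InnerProductSpace ℂ K] [FiniteDimensional ℂ K]
    (Z : H →ₗ⋆[ℂ] Op K) (hZ : IsCARField Z) (hirr : ActsIrreducibly Z)
    (G A : Op H) (hA : 0 ≤ A) (hAG : A ≤ -G - star G) :
    ∃ T : Op H,
      Tendsto (fun ε : ℝ =>
          invSqrt ((2 : ℂ) • dissipativePart G + (ε : ℂ) • 1) * A *
            invSqrt ((2 : ℂ) • dissipativePart G + (ε : ℂ) • 1)) (𝓝[>] 0) (𝓝 T) ∧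
      0 ≤ T ∧ T ≤ 1 ∧
      ∀ (η : OrthonormalBasis (Fin (Module.finrank ℂ H)) ℂ H)
        (lam : Fin (Module.finrank ℂ H) → ℝ) (φ : Fin (Module.finrank ℂ H) → H),
        (∀ j, T (η j) = (lam j : ℂ) • η j) →
        (∀ j, φ j = CFC.sqrt ((2 : ℂ) • dissipativePart G) (η j)) →
        (∀ j, 0 ≤ lam j ∧ lam j ≤ 1) ∧
        ∀ X : Op K,
          Tendsto (fun t : ℝ => (t : ℂ)⁻¹ •
              (ehkDual Z (NormedSpace.exp ((t : ℂ) • G)) (covarianceIntegral G A t) X - X))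
            (𝓝[>] 0)
            (𝓝 (∑ j, ((1 - lam j : ℝ) : ℂ) •
                    (star (Z (φ j)) * parityOp Z * X * parityOp Z * Z (φ j)
                      - (1 / 2 : ℂ) • (star (Z (φ j)) * Z (φ j) * X)
                      - (1 / 2 : ℂ) • (X * (star (Z (φ j)) * Z (φ j))))
                + ∑ j, ((lam j : ℝ) : ℂ) •
                    (Z (φ j) * parityOp Z * X * parityOp Z * star (Z (φ j))
                      - (1 / 2 : ℂ) • (Z (φ j) * star (Z (φ j)) * X)
                      - (1 / 2 : ℂ) • (X * (Z (φ j) * star (Z (φ j)))))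
                - Complex.I • (secondQuant Z (hamiltonianPart G) * X
                    - X * secondQuant Z (hamiltonianPart G)))) := by
  have hD : 0 ≤ -G - star G := hA.trans hAG
  rw [two_smul_dissipativePart]
  refine ⟨invSqrt (-G - star G) * A * invSqrt (-G - star G), tendsto_invSqrt_conj hA hAG,
    invSqrt_conj_nonneg _ hA, invSqrt_conj_le_one hA hAG, fun η lam φ hη hφ => ⟨fun j =>
      eigenvalue_bounds (invSqrt_conj_nonneg _ hA) (invSqrt_conj_le_one hA hAG)
        (η.orthonormal.1 j) (hη j), fun X => ?_⟩⟩
  obtain rfl : φ = fun j => CFC.sqrt (-G - star G) (η j) := funext hφ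
  have h := hZ.tendsto_noiseExpect_dilated hirr hA hAG lam
    (fun j => CFC.sqrt (-G - star G) (η j)) (sum_inner_sqrt hD η)
    (sum_inner_sqrt_eigenvalue (invSqrt_conj_nonneg _ hA) (sqrt_conj_invSqrt_conj hA hAG) η lam hη)
    X
  -- The Heisenberg formula is needed only for `t > 0`, where the ancilla symbol is positive and
  -- hence symmetric.
  have hlim := h.congr' (f₂ := fun t : ℝ => (t : ℂ)⁻¹ •
      (ehkDual Z (NormedSpace.exp ((t : ℂ) • G)) (covarianceIntegral G A t) X - X)) (by
    filter_upwards [self_mem_nhdsWithin] with t ht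
    have hs := isSymmetric_of_nonneg (ancillaSymbol_bounds hA hAG (le_of_lt ht)).1
    rw [← hZ.ehkDual_eq hs]
    rfl)
  simpa only [lindblad, dissipator, parityConj, star_star, mul_assoc] using hlim
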